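/- **Theorem 4.3.** Let $q\in\mathbb C$, $q\neq 0$, not a root of unity. Work with formal power series in $x$ and $t=(t_1,t_2,\dots)$ over $\mathbb C$; write $\partial_j=\partial/\partial t_j$, $D_qf(x)=\frac{f(qx)-f(x)}{(q-1)x}$, and $e_p(x)=\sum_{k\ge 0}\frac{(1-p)^k x^k}{(1-p)\cdots(1-p^k)}$. Pseudo-$q$-difference operators are formal sums $\sum_{i\le N}p_i(x,t)D_q^i$, multiplied by the rule $$D_q^i\circ f=\sum_{k\ge0}\left[{i\atop k}\right]_q (D_q^kf)(q^{i-k}x)\,D_q^{i-k}\quad(i\in\mathbb Z),\qquad \left[{i\atop k}\right]_q=\prod_{l=0}^{k-1}\frac{1-q^{i-l}}{1-q^{l+1}};$$ the subscripts $+$ and $-$ denote the parts with $i\ge 0$ and $i<0$. The adjoint is $\big(\sum p_iD_q^i\big)^*=\sum (D_q^*)^i\circ p_i$ with $D_q^*=-q^{-1}D_{1/q}$, and $\big(\sum u_i(x)D_{1/q}^i\big)_{x/q}=\sum u_i(x/q)\,q^iD_{1/q}^i$. Let $L=D_q+a_0+\sum_{i\ge1}a_iD_q^{-i}$ be a solution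 of the $q$-KP hierarchy $\partial_jL=[(L^j)_+,L]$ $(j\ge1)$ with gauge operator $S=1+\sum_{j\ge1}\tilde w_j(x,t)D_q^{-j}$, that is, $L=SD_qS^{-1}$ and $\partial_jS=-(L^j)_-S$ for all $j\ge 1$. Put $\xi(t,z)=\sum_{i\ge1}t_iz^i$ and define the wave function and the adjoint wave function $$\psi_q(x,t,z)=\big(S\,e_q(xz)\big)e^{\xi(t,z)},\qquad \psi_q^*(x,t,z)=\big((S^*)^{-1}_{x/q}\,e_{1/q}(-xz)\big)e^{-\xi(t,z)},$$ where $D_q^ie_q(xz)=z^ie_q(xz)$ and $D_{1/q}^ie_{1/q}(-xz)=(-z)^ie_{1/q}(-xz)$ for all $i\in\mathbb Z$; they are power series in $x,t$ whose coefficients are formal Laurent series in $z^{-1}$. Then for every integer $n\ge0$ and every multi-index $\alpha=(\alpha_1,\alpha_2,\dots)$ with finitely many nonzero entries, $$\oint\big(D_q^n\partial^\alpha\psi_q(x,t,z)\big)\,\psi_q^*(x',t',z)\,dz=0$$ identically in the independent variables $(x,t)$ and $(x',t')$, as formal power series in $x,t,x',t'$; here $\partial^\alpha=\partial_1^{\alpha_1}\partial_2^{\alpha_2}\cdots$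 and $D_q$ act on the variables $(x,t)$, and $\oint\cdot\,dz$ is, up to the factor $2\pi i$, the residue, i.e. the coefficient of $z^{-1}$. -/

import Mathlib

noncomputable section

namespace QKP

/-- The variables of the hierarchy: `none` is `x` and `some i` is the time `t i`, `i = 1, 2, …`. -/
abbrev Var : Type := Option ℕ+

/-- Formal power series in `x, t₁, t₂, …` with coefficients in `R`. -/
abbrev Ser (R : Type) : Type := MvPowerSeries Var R

/-- Formal Laurent series in `z⁻¹`; the index `k` of such a series belongs to `z ^ (-k)`. -/
abbrev ZSer : Type := LaurentSeries ℂ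

/-- The spectral variable `z`. -/
def z : ZSer := HahnSeries.single (-1) 1

section Operations

variable {R : Type} [CommRing R]

/-- The partial derivative `∂ / ∂ t j`. -/
def dt (j : ℕ+) (f : Ser R) : Ser R := MvPowerSeries.pderiv R (some j) f

theorem dt_comm (i j : ℕ+) (f : Ser R) : dt i (dt j f) = dt j (dt i f) := by
  ext m
  simp only [dt, MvPowerSeries.coeff_pderiv, Finsupp.add_apply]
  rw [add_right_comm]
  rcases eq_or_ne i j with rfl | h
  · rfl
  · have h1 : (some i : Var) ≠ some j := fun e => h (Option.some.inj e)
    rw [Finsupp.single_eq_of_ne h1, Finsupp.single_eq_of_ne h1.symm]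
    push_cast
    ring

instance : LeftCommutative (dt : ℕ+ → Ser R → Ser R) := ⟨fun i j f => dt_comm i j f⟩

/-- `∂ ^ α` for a multi-index `α` in the times. -/
def dtMulti (α : ℕ+ →₀ ℕ) (f : Ser R) : Ser R := (Finsupp.toMultiset α).foldr dt f

variable [Algebra ℂ R]

/-- The dilation `f(x, t) ↦ f(p ^ n * x, t)`, `n ∈ ℤ`. -/
def shift (p : ℂ) (n : ℤ) (f : Ser R) : Ser R :=
  fun m => (p ^ (n * (m none : ℤ))) • MvPowerSeries.coeff m f

/-- The `p`-derivative in `x`, `(f(p x, t) - f(x, t)) / ((p - 1) x)`: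
it sends `x ^ (k + 1)` to `(p ^ (k + 1) - 1) / (p - 1) * x ^ k`. -/
def qD (p : ℂ) (f : Ser R) : Ser R :=
  fun m => ((p ^ (m none + 1) - 1) / (p - 1)) •
    MvPowerSeries.coeff (m + Finsupp.single none 1) f

/-- The `p`-exponential `e_p(a x) = ∑ (1 - p) ^ k (a x) ^ k / ((1 - p) ⋯ (1 - p ^ k))`. -/
def qExp (p : ℂ) (a : R) : Ser R :=
  fun m => if m.some = 0 then
    ((1 - p) ^ (m none) / ∏ l ∈ Finset.range (m none), (1 - p ^ (l + 1))) • a ^ (m none)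
  else 0

/-- The exponential `exp (∑ i, c i * t i) = ∏ i, ∑ k, (c i * t i) ^ k / k!`. -/
def expT (c : ℕ+ → R) : Ser R :=
  fun m => if m none = 0 then m.some.prod fun i k => ((k.factorial : ℂ)⁻¹) • c i ^ k else 0

end Operations

/-- The Gaussian binomial coefficient with an integer upper entry,
`∏ l < k, (1 - p ^ (n - l)) / (1 - p ^ (l + 1))`. -/
def qBinom (p : ℂ) (n : ℤ) (k : ℕ) : ℂ :=
  ∏ l ∈ Finset.range k, (1 - p ^ (n - (l : ℤ))) / (1 - p ^ (l + 1))

/-- Formal pseudo-`p`-difference operators `∑ i ≤ N, P_i(x, t) D_p ^ i`,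
with coefficients on the left. -/
@[ext]
structure PDO (p : ℂ) where
  coeff : ℤ → Ser ℂ
  bdd : ∃ N : ℤ, ∀ i, N < i → coeff i = 0

namespace PDO

variable {p : ℂ}

instance : One (PDO p) := ⟨⟨fun i => if i = 0 then 1 else 0, 0, fun _ hi => if_neg hi.ne'⟩⟩

/-- The operator `D_p`. -/
def D (p : ℂ) : PDO p := ⟨fun i => if i = 1 then 1 else 0, 1, fun _ hi => if_neg hi.ne'⟩

instance : Neg (PDO p) := ⟨fun P => ⟨fun i => -P.coeff i, by
  obtain ⟨N, hN⟩ := P.bdd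
  exact ⟨N, fun i hi => by simp [hN i hi]⟩⟩⟩

instance : Sub (PDO p) := ⟨fun P Q => ⟨fun i => P.coeff i - Q.coeff i, by
  obtain ⟨N, hN⟩ := P.bdd
  obtain ⟨M, hM⟩ := Q.bdd
  exact ⟨max N M, fun i hi => by
    simp [hN i (lt_of_le_of_lt (le_max_left _ _) hi),
      hM i (lt_of_le_of_lt (le_max_right _ _) hi)]⟩⟩⟩

/-- The left coefficient of `D_p ^ (i - k)` in the expansion
`D_p ^ i ∘ f = ∑ k ≥ 0, [i choose k]_p (D_p ^ k f)(p ^ (i - k) x) D_p ^ (i - k)`, `i ∈ ℤ`. -/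
def leibniz (p : ℂ) (i : ℤ) (k : ℕ) (f : Ser ℂ) : Ser ℂ :=
  qBinom p i k • shift p (i - k) ((qD p)^[k] f)

theorem qD_zero : qD p (0 : Ser ℂ) = 0 := by
  ext m
  exact smul_zero _

theorem shift_zero (a : ℂ) (n : ℤ) : shift a n (0 : Ser ℂ) = 0 := by
  ext m
  exact smul_zero _

theorem leibniz_zero (i : ℤ) (k : ℕ) : leibniz p i k 0 = 0 := by
  have h : (qD p)^[k] (0 : Ser ℂ) = 0 := Function.iterate_fixed qD_zero k
  rw [leibniz, h, shift_zero, smul_zero]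

/-- The term of index `(i, k)` in the coefficient of `D_p ^ m` of the product of `P` and `Q`: it
comes from `P_i D_p ^ i ∘ Q_j D_p ^ j` with `i + j - k = m`. -/
def mulTerm (P Q : PDO p) (m : ℤ) (s : ℤ × ℕ) : Ser ℂ :=
  P.coeff s.1 * leibniz p s.1 s.2 (Q.coeff (m - s.1 + s.2))

theorem mulTerm_eq_zero {P Q : PDO p} {N M : ℤ} (hN : ∀ i, N < i → P.coeff i = 0)
    (hM : ∀ i, M < i → Q.coeff i = 0) (m : ℤ) (s : ℤ × ℕ)
    (h : N < s.1 ∨ M < m - s.1 + s.2) : mulTerm P Q m s = 0 := by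
  rcases h with h | h
  · rw [mulTerm, hN _ h, zero_mul]
  · rw [mulTerm, hM _ h, leibniz_zero, mul_zero]

/-- Only finitely many terms contribute to a coefficient of a product. -/
theorem mulTerm_support_finite (P Q : PDO p) (m : ℤ) :
    (Function.support (mulTerm P Q m)).Finite := by
  obtain ⟨N, hN⟩ := P.bdd
  obtain ⟨M, hM⟩ := Q.bdd
  refine Set.Finite.subset ((Set.finite_Icc (m - M) N).prod
    (Set.finite_Iic (M - m + N).toNat)) fun s hs => ?_
  have h : ¬ (N < s.1 ∨ M < m - s.1 + s.2) := fun h => hs (mulTerm_eq_zero hN hM m s h)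
  simp only [Set.mem_prod, Set.mem_Icc, Set.mem_Iic]
  omega

instance : Mul (PDO p) := ⟨fun P Q => ⟨fun m => ∑ᶠ s : ℤ × ℕ, mulTerm P Q m s, by
  obtain ⟨N, hN⟩ := P.bdd
  obtain ⟨M, hM⟩ := Q.bdd
  refine ⟨N + M, fun m hm => finsum_eq_zero_of_forall_eq_zero fun s => ?_⟩
  exact mulTerm_eq_zero hN hM m s (by omega)⟩⟩

/-- The power `P ^ k`. -/
def power (P : PDO p) : ℕ → PDO p
  | 0 => 1
  | k + 1 => P * power P k

/-- The differential part `P_+ = ∑ i ≥ 0, P_i D_p ^ i`. -/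
def pos (P : PDO p) : PDO p := ⟨fun i => if 0 ≤ i then P.coeff i else 0, by
  obtain ⟨N, hN⟩ := P.bdd
  exact ⟨N, fun i hi => by simp [hN i hi]⟩⟩

/-- The integral part `P_- = ∑ i < 0, P_i D_p ^ i`. -/
def neg (P : PDO p) : PDO p := ⟨fun i => if i < 0 then P.coeff i else 0, by
  obtain ⟨N, hN⟩ := P.bdd
  exact ⟨N, fun i hi => by simp [hN i hi]⟩⟩

/-- The derivative of the coefficients of `P` with respect to `t j`. -/
def tderiv (j : ℕ+) (P : PDO p) : PDO p := ⟨fun i => dt j (P.coeff i), by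
  obtain ⟨N, hN⟩ := P.bdd
  exact ⟨N, fun i hi => by simp [hN i hi, dt]⟩⟩

/-- `P = 1 + ∑ i < 0, P_i D_p ^ i`. -/
def IsMonic (P : PDO p) : Prop := P.coeff 0 = 1 ∧ ∀ i, 0 < i → P.coeff i = 0

/-- The inverse of a monic operator of order zero, as the geometric series `∑ k, (1 - P) ^ k`:
`(1 - P) ^ k` has order at most `-k`, so that only `k ≤ -i` contribute to the coefficient of
`D_p ^ i`. -/
def inv (P : PDO p) : PDO p :=
  ⟨fun i => if i ≤ 0 then
      ∑ k ∈ Finset.range ((-i).toNat + 1), (power (1 - P) k).coeff i else 0,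
    0, fun _ hi => if_neg (not_le.mpr hi)⟩

/-- The formal adjoint `P^* = ∑ i, (D_p^*) ^ i ∘ P_i` with `D_p^* = -(1 / p) D_{1/p}`, a
pseudo-`(1 / p)`-difference operator; the coefficient of `D_{1/p} ^ m` collects the contributions
of `P_(m + k)`, `k ≥ 0`. -/
def adjoint (P : PDO p) : PDO p⁻¹ :=
  ⟨fun m => ∑ᶠ k : ℕ, ((-p⁻¹) ^ (m + k)) • leibniz p⁻¹ (m + k) k (P.coeff (m + k)), by
    obtain ⟨N, hN⟩ := P.bdd
    refine ⟨N, fun m hm => finsum_eq_zero_of_forall_eq_zero fun k => ?_⟩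
    rw [hN _ (by omega), leibniz_zero, smul_zero]⟩

/-- The substitution `P_{x/a} = ∑ i, P_i(x / a, t) a ^ i D_p ^ i`. -/
def rescale (a : ℂ) (P : PDO p) : PDO p :=
  ⟨fun i => (a ^ i) • shift a (-1) (P.coeff i), by
    obtain ⟨N, hN⟩ := P.bdd
    refine ⟨N, fun i hi => ?_⟩
    rw [hN i hi, shift_zero, smul_zero]⟩

/-- The symbol `∑ i, P_i(x, t) (c z) ^ i`, a power series in `x, t` whose coefficients are
Laurent series in `z⁻¹`. -/
def symbol (c : ℂ) (P : PDO p) : Ser ZSer := fun m =>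
  HahnSeries.ofSuppBddBelow (fun k : ℤ => c ^ (-k) * MvPowerSeries.coeff m (P.coeff (-k))) (by
    obtain ⟨N, hN⟩ := P.bdd
    refine ⟨-N, fun k hk => ?_⟩
    by_contra h
    exact hk (by simp [hN (-k) (by omega)]))

/-- The action of `P` on `e_p(c x z)`, determined by
`D_p ^ i e_p(c x z) = (c z) ^ i e_p(c x z)` for all `i ∈ ℤ`. -/
def actExp (c : ℂ) (P : PDO p) : Ser ZSer := symbol c P * qExp p (c • z)

end PDO

open PDO

/-- `L` is a solution of the `q`-KP hierarchy with gauge (dressing) operator `S`. -/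
structure IsSolution {q : ℂ} (L S : PDO q) : Prop where
  monic : S.IsMonic
  /-- `L = S D_q S⁻¹`. -/
  gauge : L = S * D q * S.inv
  /-- `∂_j L = [(L ^ j)_+, L]`. -/
  lax : ∀ j : ℕ+, L.tderiv j = (L.power j).pos * L - L * (L.power j).pos
  /-- `∂_j S = -(L ^ j)_- S`. -/
  sato : ∀ j : ℕ+, S.tderiv j = -((L.power j).neg * S)

/-- The wave function `ψ_q(x, t, z) = (S e_q(x z)) exp (∑ i, t i * z ^ i)`. -/
def wave {q : ℂ} (S : PDO q) : Ser ZSer :=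
  S.actExp 1 * expT fun i => z ^ (i : ℕ)

/-- The adjoint wave function
`ψ_q^*(x, t, z) = ((S^*)⁻¹_{x/q} e_{1/q}(-x z)) exp (-∑ i, t i * z ^ i)`. -/
def adjointWave {q : ℂ} (S : PDO q) : Ser ZSer :=
  (S.adjoint.inv.rescale q).actExp (-1) * expT fun i => -z ^ (i : ℕ)

/-- `F(x, t) G(x', t')` as a power series in two independent sets of variables. -/
def tensor (F G : Ser ZSer) : MvPowerSeries (Var ⊕ Var) ZSer :=
  MvPowerSeries.rename Function.Embedding.inl F * MvPowerSeries.rename Function.Embedding.inr G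

/-- The residue in `z`: the coefficient of `z⁻¹`, taken in every coefficient of the power series.
Up to the factor `2 π i` this is the contour integral in `z`. -/
def residue {σ : Type} (F : MvPowerSeries σ ZSer) : MvPowerSeries σ ℂ :=
  fun m => HahnSeries.coeff (MvPowerSeries.coeff m F) 1

end QKP

end

noncomputable section

namespace QKP

/-! On the diagonal `(x', t') = (x, t)` the identity is a statement about operators. The Sato
equation gives `∂_j S + S D_q^j = (L^j)_+ S`, so every derivative of the wave function is `(B S
e_q(xz)) e^ξ` with `B` free of negative powers of `D_q` (`IsSolution.exists_derivative`). The
exponentials cancel, because `e_q(xz) e_{1/q}(-xz) = 1`, and the residue of the product of the two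
symbols is a bilinear `pairing` of `B S` with `(S^*)⁻¹`. The key fact is `pairing_mul`: `⟨P Q, V⟩ =
⟨P, V Q^*⟩`. Hence the residue is `⟨B, (S^*)⁻¹ S^*⟩ = ⟨B, 1⟩`, the coefficient of `D_q⁻¹` in `B`,
which is zero. On single powers of `D_q` and `D_{1/q}`, `pairing_mul` is a reflection of Gaussian
binomials under `q ↦ 1/q` (`leibniz_reflect`).

The diagonal case for all derivatives implies the general one. Since `q` is not a root of unity,
each coefficient of `ψ_q` is, up to a nonzero factor, the constant term of some derivative of `ψ_q`;
induction on the exponent in the second factor then isolates each product of coefficients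
(`coeff_mul_coeff_eq_zero`).

The operator algebra rests on one device: the operators `D_p^i Q`, `i ∈ ℤ`, are determined by the
one-step rule for `D_p` and the injectivity of left multiplication by `D_p`. -/

/-- `p` is nonzero and not a root of unity. -/
structure Generic (p : ℂ) : Prop where
  ne_zero : p ≠ 0
  pow_ne_one : ∀ k : ℕ, 0 < k → p ^ k ≠ 1

theorem Generic.inv {p : ℂ} (hp : Generic p) : Generic p⁻¹ :=
  ⟨inv_ne_zero hp.ne_zero, fun k hk h => hp.pow_ne_one k hk (by simpa using h)⟩

theorem Generic.ne_one {p : ℂ} (hp : Generic p) : p ≠ 1 := by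
  simpa using hp.pow_ne_one 1 one_pos

theorem Generic.one_sub_ne_zero {p : ℂ} (hp : Generic p) (l : ℕ) : 1 - p ^ (l + 1) ≠ 0 :=
  sub_ne_zero.mpr (hp.pow_ne_one _ l.succ_pos).symm

/-! ### Dilations, `p`-derivatives and exponential series -/

section Operations

variable {R : Type} [CommRing R]

theorem coeff_dt (j : ℕ+) (f : Ser R) (m : Var →₀ ℕ) :
    MvPowerSeries.coeff m (dt j f) =
      MvPowerSeries.coeff (m + Finsupp.single (some j) 1) f * ((m (some j) : R) + 1) := by
  simp [dt, MvPowerSeries.coeff_pderiv]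

theorem dt_mul (j : ℕ+) (f g : Ser R) : dt j (f * g) = f * dt j g + dt j f * g := by
  simp only [dt, Derivation.leibniz, smul_eq_mul]
  ring

variable [Algebra ℂ R] {p : ℂ}

theorem coeff_complex_smul (c : ℂ) (f : Ser R) (m : Var →₀ ℕ) :
    MvPowerSeries.coeff m (c • f) = c • MvPowerSeries.coeff m f :=
  rfl

theorem coeff_shift (n : ℤ) (f : Ser R) (m : Var →₀ ℕ) :
    MvPowerSeries.coeff m (shift p n f) = (p ^ (n * (m none : ℤ))) • MvPowerSeries.coeff m f :=
  rfl

theorem coeff_qD (f : Ser R) (m : Var →₀ ℕ) :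
    MvPowerSeries.coeff m (qD p f) = ((p ^ (m none + 1) - 1) / (p - 1)) •
      MvPowerSeries.coeff (m + Finsupp.single none 1) f :=
  rfl

/-- The dilation as a linear map. -/
def shiftHom (p : ℂ) (n : ℤ) : Ser R →ₗ[ℂ] Ser R where
  toFun := shift p n
  map_add' f g := by ext m; simp only [coeff_shift, map_add, smul_add]
  map_smul' c f := by
    ext m
    simp only [coeff_shift, coeff_complex_smul, RingHom.id_apply, smul_smul, mul_comm]

/-- The `p`-derivative as a linear map. -/
def qDHom (p : ℂ) : Ser R →ₗ[ℂ] Ser R where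
  toFun := qD p
  map_add' f g := by ext m; simp only [coeff_qD, map_add, smul_add]
  map_smul' c f := by
    ext m
    simp only [coeff_qD, coeff_complex_smul, RingHom.id_apply, smul_smul, mul_comm]

theorem shift_smul (n : ℤ) (c : ℂ) (f : Ser R) : shift p n (c • f) = c • shift p n f :=
  (shiftHom p n).map_smul c f

theorem qD_smul (c : ℂ) (f : Ser R) : qD p (c • f) = c • qD p f := (qDHom p).map_smul c f

theorem shift_shift (hp : p ≠ 0) (a b : ℤ) (f : Ser R) :
    shift p a (shift p b f) = shift p (a + b) f := by
  ext m
  simp only [coeff_shift, smul_smul, ← zpow_add₀ hp, add_mul]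

theorem shift_zero_left (f : Ser R) : shift p 0 f = f := by
  ext m
  simp [coeff_shift]

theorem shift_inv (n : ℤ) (f : Ser R) : shift p⁻¹ n f = shift p (-n) f := by
  ext m
  simp [coeff_shift]

theorem shift_injective (hp : p ≠ 0) (n : ℤ) : Function.Injective (shift p n : Ser R → Ser R) :=
  Function.LeftInverse.injective (g := shift p (-n)) fun f => by
    rw [shift_shift hp, neg_add_cancel, shift_zero_left]

theorem shift_mul (hp : p ≠ 0) (n : ℤ) (f g : Ser R) :
    shift p n (f * g) = shift p n f * shift p n g := by
  classical
  ext m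
  simp only [coeff_shift, MvPowerSeries.coeff_mul, Finset.smul_sum]
  refine Finset.sum_congr rfl fun s hs => ?_
  rw [smul_mul_smul_comm, ← zpow_add₀ hp, ← Finset.HasAntidiagonal.mem_antidiagonal.mp hs]
  simp [mul_add]

theorem shift_one (n : ℤ) : shift p n (1 : Ser R) = 1 := by
  classical
  ext m
  rw [coeff_shift, MvPowerSeries.coeff_one]
  split_ifs with h
  · simp [h]
  · simp

theorem qD_one : qD p (1 : Ser R) = 0 := by
  classical
  ext m
  rw [coeff_qD, MvPowerSeries.coeff_one, if_neg, smul_zero, map_zero]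
  intro h
  simpa using DFunLike.congr_fun h none

/-- The defining property of the `p`-derivative. -/
theorem X_mul_qD (hp : p ≠ 1) (f : Ser R) :
    (p - 1) • (MvPowerSeries.X none * qD p f) = shift p 1 f - f := by
  classical
  ext m
  rw [coeff_complex_smul, MvPowerSeries.X, MvPowerSeries.coeff_monomial_mul]
  simp only [map_sub, coeff_shift, coeff_qD, one_mul]
  split_ifs with h
  · have h1 : 1 ≤ m none := by simpa using h none
    rw [tsub_add_cancel_of_le h]
    simp only [Finsupp.coe_tsub, Pi.sub_apply, Finsupp.single_eq_same, Nat.sub_add_cancel h1,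
      zpow_natCast, smul_smul, mul_div_cancel₀ _ (sub_ne_zero.mpr hp), sub_smul, one_smul]
  · have h0 : m none = 0 := by
      by_contra h0
      refine h (Finsupp.single_le_iff.mpr ?_)
      omega
    simp [h0]

/-- Together with `X_mul_qD` this reduces identities for the `p`-derivative to identities for
dilations. -/
theorem X_mul_cancel (hp : p ≠ 1) {f g : Ser R}
    (h : (p - 1) • ((MvPowerSeries.X none : Ser R) * f) = (p - 1) • (MvPowerSeries.X none * g)) :
    f = g := by
  classical
  have h' := smul_right_injective (Ser R) (sub_ne_zero.mpr hp) h
  ext m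
  have := congrArg (MvPowerSeries.coeff (Finsupp.single none 1 + m)) h'
  simpa [MvPowerSeries.X, MvPowerSeries.coeff_add_monomial_mul] using this

/-- The twisted Leibniz rule. -/
theorem qD_mul (hp : Generic p) (f g : Ser R) :
    qD p (f * g) = shift p 1 f * qD p g + qD p f * g := by
  apply X_mul_cancel hp.ne_one
  have h : (p - 1) • ((MvPowerSeries.X none : Ser R) * (shift p 1 f * qD p g + qD p f * g)) =
      shift p 1 f * ((p - 1) • (MvPowerSeries.X none * qD p g)) +
        ((p - 1) • (MvPowerSeries.X none * qD p f)) * g := by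
    rw [mul_smul_comm, smul_mul_assoc, ← smul_add]
    congr 1
    ring
  rw [h]
  simp only [X_mul_qD hp.ne_one]
  rw [shift_mul hp.ne_zero]
  ring

theorem qD_shift (hp : p ≠ 0) (n : ℤ) (f : Ser R) :
    qD p (shift p n f) = p ^ n • shift p n (qD p f) := by
  ext m
  simp only [coeff_qD, coeff_shift, coeff_complex_smul, smul_smul]
  congr 1
  simp [mul_add, zpow_add₀ hp]
  ring

/-- Both sides are the difference quotient of `f` over the same two points `x / p` and `x`. -/
theorem qD_inv (hp : Generic p) (f : Ser R) : qD p⁻¹ f = shift p (-1) (qD p f) := by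
  ext m
  simp only [coeff_qD, coeff_shift, smul_smul]
  congr 1
  have h0 := hp.ne_zero
  have h1 := sub_ne_zero.mpr hp.ne_one
  have h2 := sub_ne_zero.mpr hp.inv.ne_one
  rw [neg_one_mul, zpow_neg, zpow_natCast, inv_pow, pow_succ]
  have : p⁻¹ - 1 = -(p - 1) * p⁻¹ := by field_simp; ring
  rw [this]
  field_simp
  ring

/-- A series annihilated by all derivations is constant. -/
theorem eq_one_of_derivatives (hp : Generic p) {G : Ser R} (h0 : MvPowerSeries.constantCoeff G = 1)
    (hx : qD p G = 0) (ht : ∀ j, dt j G = 0) : G = 1 := by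
  classical
  ext m
  rw [MvPowerSeries.coeff_one]
  split_ifs with hm
  · rw [hm, MvPowerSeries.coeff_zero_eq_constantCoeff_apply, h0]
  · obtain ⟨i, hi⟩ := Finsupp.ne_iff.mp hm
    obtain ⟨m', rfl⟩ : ∃ m', m = m' + Finsupp.single i 1 :=
      ⟨m - Finsupp.single i 1, (tsub_add_cancel_of_le (Finsupp.single_le_iff.mpr
        (Nat.one_le_iff_ne_zero.mpr hi))).symm⟩
    cases i with
    | none =>
      have := congrArg (MvPowerSeries.coeff m') hx
      rw [coeff_qD, map_zero] at this
      refine (smul_eq_zero.mp this).resolve_left (div_ne_zero ?_ (sub_ne_zero.mpr hp.ne_one))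
      exact sub_ne_zero.mpr (hp.pow_ne_one _ (Nat.succ_pos _))
    | some j =>
      have := congrArg (MvPowerSeries.coeff m') (ht j)
      rw [coeff_dt, map_zero] at this
      have h2 : ((m' (some j) : ℂ) + 1) • MvPowerSeries.coeff (m' + Finsupp.single (some j) 1) G
          = 0 := by
        rw [← this, Algebra.smul_def, mul_comm]
        simp
      exact (smul_eq_zero.mp h2).resolve_left (Nat.cast_add_one_ne_zero _)

theorem qD_qExp (hp : Generic p) (a : R) : qD p (qExp p a) = MvPowerSeries.C a * qExp p a := by
  ext m
  rw [coeff_qD, MvPowerSeries.coeff_C_mul]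
  simp only [qExp, MvPowerSeries.coeff_apply]
  have h : (m + Finsupp.single none 1).some = m.some := by ext; simp
  rw [h]
  split_ifs
  · simp only [Finsupp.add_apply, Finsupp.single_eq_same, Finset.prod_range_succ, pow_succ,
      smul_smul, mul_smul_comm]
    rw [mul_comm a]
    congr 1
    have h1 := sub_ne_zero.mpr hp.ne_one
    have h2 := hp.one_sub_ne_zero (m none)
    have h3 : ∏ l ∈ Finset.range (m none), (1 - p ^ l * p) ≠ 0 :=
      Finset.prod_ne_zero_iff.mpr fun l _ => hp.one_sub_ne_zero l
    rw [pow_succ] at h2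
    field_simp
    ring
  · simp

theorem dt_qExp (j : ℕ+) (a : R) : dt j (qExp p a) = 0 := by
  ext m
  rw [coeff_dt]
  simp only [qExp, MvPowerSeries.coeff_apply]
  rw [if_neg, zero_mul]
  · rfl
  · intro h
    simpa using DFunLike.congr_fun h j

theorem constantCoeff_qExp (a : R) : MvPowerSeries.constantCoeff (qExp p a) = 1 := by
  rw [← MvPowerSeries.coeff_zero_eq_constantCoeff_apply, MvPowerSeries.coeff_apply]
  simp [qExp]

theorem qD_expT (c : ℕ+ → R) : qD p (expT c) = 0 := by
  ext m
  rw [coeff_qD]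
  simp [expT, MvPowerSeries.coeff_apply]
  rfl

theorem constantCoeff_expT (c : ℕ+ → R) : MvPowerSeries.constantCoeff (expT c) = 1 := by
  rw [← MvPowerSeries.coeff_zero_eq_constantCoeff_apply, MvPowerSeries.coeff_apply]
  simp [expT]

theorem dt_expT (c : ℕ+ → R) (j : ℕ+) : dt j (expT c) = MvPowerSeries.C (c j) * expT c := by
  classical
  ext m
  rw [coeff_dt, MvPowerSeries.coeff_C_mul]
  simp only [expT, MvPowerSeries.coeff_apply]
  have h : (m + Finsupp.single (some j) 1).some = m.some + Finsupp.single j 1 := by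
    ext i; simp [Finsupp.single_apply]
  have h0 : (m + Finsupp.single (some j) 1 : Var →₀ ℕ) none = m none := by simp
  rw [h, h0]
  split_ifs
  · set u := m.some
    have hu : m (some j) = u j := rfl
    rw [hu]
    -- The factor of the variable `t j` is split off, since raising its exponent changes no other
    -- factor.
    have key : ∀ v : ℕ+ →₀ ℕ, v.prod (fun i k => ((k.factorial : ℂ)⁻¹) • c i ^ k) =
        (((v j).factorial : ℂ)⁻¹ • c j ^ v j) *
          (v.erase j).prod (fun i k => ((k.factorial : ℂ)⁻¹) • c i ^ k) := by
      intro v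
      by_cases hv : j ∈ v.support
      · exact (Finsupp.mul_prod_erase v j _ hv).symm
      · rw [Finsupp.erase_of_notMem_support hv, Finsupp.notMem_support_iff.mp hv]
        simp
    have he : (u + Finsupp.single j 1).erase j = u.erase j := by
      ext i
      by_cases hi : i = j
      · simp [hi]
      · simp [Finsupp.erase_ne hi]
    rw [key (u + _), key u, he]
    simp only [Finsupp.add_apply, Finsupp.single_eq_same, Nat.factorial_succ, pow_succ]
    have hc : ((u j : R) + 1) = algebraMap ℂ R ((u j : ℂ) + 1) := by simp
    rw [hc]
    simp only [Algebra.smul_def]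
    have h1 : ((u j : ℂ) + 1) ≠ 0 := Nat.cast_add_one_ne_zero _
    have h2 : algebraMap ℂ R (((u j + 1) * (u j).factorial : ℕ) : ℂ)⁻¹ *
        algebraMap ℂ R ((u j : ℂ) + 1) = algebraMap ℂ R ((u j).factorial : ℂ)⁻¹ := by
      rw [← map_mul]
      congr 1
      push_cast
      field_simp
    rw [← h2]
    ring
  · simp

theorem expT_mul_expT_neg (hp : Generic p) (c : ℕ+ → R) : expT c * expT (fun i => -c i) = 1 := by
  refine eq_one_of_derivatives hp ?_ ?_ fun j => ?_
  · rw [map_mul, constantCoeff_expT, constantCoeff_expT, one_mul]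
  · rw [qD_mul hp, qD_expT, qD_expT, mul_zero, zero_mul, add_zero]
  · rw [dt_mul, dt_expT, dt_expT, map_neg]
    ring

theorem qExp_mul_qExp_inv (hp : Generic p) (a : R) : qExp p a * qExp p⁻¹ (-a) = 1 := by
  refine eq_one_of_derivatives hp ?_ ?_ fun j => ?_
  · rw [map_mul, constantCoeff_qExp, constantCoeff_qExp, one_mul]
  · have h1 : qD p (qExp p⁻¹ (-a)) = shift p 1 (qD p⁻¹ (qExp p⁻¹ (-a))) := by
      rw [qD_inv hp, shift_shift hp.ne_zero, add_neg_cancel, shift_zero_left]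
    have h2 : shift p 1 (MvPowerSeries.C (-a) : Ser R) = MvPowerSeries.C (-a) := by
      classical
      ext m
      rw [coeff_shift, MvPowerSeries.coeff_C]
      split_ifs with h <;> simp [h]
    -- The factors are swapped so that the dilation in the twisted Leibniz rule falls on `e_{1/p}`,
    -- matching `D_p e_{1/p}(-a x) = -a e_{1/p}(-a p x)`; the two terms then cancel.
    rw [mul_comm, qD_mul hp, h1, qD_qExp hp, qD_qExp hp.inv, shift_mul hp.ne_zero, h2, map_neg]
    ring
  · rw [dt_mul, dt_qExp, dt_qExp, mul_zero, zero_mul, add_zero]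

end Operations

/-! ### Finite sums over `ℤ` and Gaussian binomials -/

theorem finite_support_of_bounds {A : Type} [Zero A] {f : ℤ → A} (a b : ℤ)
    (ha : ∀ i, i < a → f i = 0) (hb : ∀ i, b < i → f i = 0) : (Function.support f).Finite := by
  refine (Set.finite_Icc a b).subset fun i hi => ⟨?_, ?_⟩
  · by_contra h
    exact hi (ha i (not_le.mp h))
  · by_contra h
    exact hi (hb i (not_le.mp h))

theorem finsum_eq_sum_Icc {A : Type} [AddCommMonoid A] {f : ℤ → A} {a b : ℤ}
    (ha : ∀ i, i < a → f i = 0) (hb : ∀ i, b < i → f i = 0) :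
    ∑ᶠ i, f i = ∑ i ∈ Finset.Icc a b, f i := by
  refine finsum_eq_sum_of_support_subset _ fun i hi => ?_
  rw [Finset.coe_Icc]
  constructor
  · by_contra h
    exact hi (ha i (not_le.mp h))
  · by_contra h
    exact hi (hb i (not_le.mp h))

theorem qBinom_zero (p : ℂ) (i : ℤ) : qBinom p i 0 = 1 := by simp [qBinom]

theorem qBinom_succ (p : ℂ) (i : ℤ) (k : ℕ) :
    qBinom p i (k + 1) = qBinom p i k * ((1 - p ^ (i - k)) / (1 - p ^ (k + 1))) := by
  rw [qBinom, Finset.prod_range_succ, qBinom]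

/-- Stated without division because `1 - p ^ (i + 1 - k)` vanishes at `k = i + 1`. -/
theorem qBinom_succ_left {p : ℂ} (hp : Generic p) (i : ℤ) (k : ℕ) :
    qBinom p (i + 1) k * (1 - p ^ (i + 1 - k)) = qBinom p i k * (1 - p ^ (i + 1)) := by
  induction k with
  | zero => simp [qBinom_zero]
  | succ k ih =>
    have h := hp.one_sub_ne_zero k
    rw [qBinom_succ, qBinom_succ]
    have e : i + 1 - ((k + 1 : ℕ) : ℤ) = i - k := by push_cast; ring
    rw [e]
    field_simp
    linear_combination (1 - p ^ (i - (k : ℤ))) * ih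

/-- The Pascal rule for Gaussian binomial coefficients with an integer upper entry. -/
theorem qBinom_pascal {p : ℂ} (hp : Generic p) (i : ℤ) (k : ℕ) :
    qBinom p (i + 1) (k + 1) = qBinom p i (k + 1) + p ^ (i - k) * qBinom p i k := by
  have h := hp.one_sub_ne_zero k
  have h1 := qBinom_succ_left hp i k
  have e : p ^ (i + 1) = p ^ (i - k) * p ^ (k + 1) := by
    rw [← zpow_natCast, ← zpow_add₀ hp.ne_zero]
    congr 1
    push_cast
    ring
  rw [qBinom_succ, qBinom_succ]
  field_simp
  rw [h1, e]
  ring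

/-! ### The ring of pseudo-`p`-difference operators -/

namespace PDO

variable {p : ℂ}

/-- `leibniz p i k` as a linear map. -/
def leibnizHom (p : ℂ) (i : ℤ) (k : ℕ) : Ser ℂ →ₗ[ℂ] Ser ℂ :=
  qBinom p i k • (shiftHom p (i - k) ∘ₗ qDHom p ^ k)

theorem leibnizHom_apply (i : ℤ) (k : ℕ) (f : Ser ℂ) : leibnizHom p i k f = leibniz p i k f := by
  simp only [leibnizHom, LinearMap.smul_apply, LinearMap.comp_apply, Module.End.pow_apply]
  rfl

theorem leibniz_add (i : ℤ) (k : ℕ) (f g : Ser ℂ) :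
    leibniz p i k (f + g) = leibniz p i k f + leibniz p i k g := by
  simp only [← leibnizHom_apply, map_add]

theorem leibniz_zero_right (i : ℤ) (f : Ser ℂ) : leibniz p i 0 f = shift p i f := by
  simp [leibniz, qBinom_zero]

/-- Composing `D_p` with the expansion of `D_p^i ∘ f` and using `D_p ∘ g = g(p x) D_p + D_p g`, two
terms meet at each power; the Pascal rule merges them. -/
theorem leibniz_succ_succ (hp : Generic p) (i : ℤ) (k : ℕ) (f : Ser ℂ) :
    leibniz p (i + 1) (k + 1) f = shift p 1 (leibniz p i (k + 1) f) + qD p (leibniz p i k f) := by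
  simp only [leibniz, shift_smul, qD_smul, shift_shift hp.ne_zero, qD_shift hp.ne_zero,
    Function.iterate_succ_apply']
  have e1 : (1 : ℤ) + (i - ((k + 1 : ℕ) : ℤ)) = i - k := by push_cast; ring
  have e2 : i + 1 - ((k + 1 : ℕ) : ℤ) = i - k := by push_cast; ring
  rw [e1, e2, smul_smul, ← add_smul, qBinom_pascal hp, mul_comm (p ^ (i - (k : ℤ)))]

theorem leibniz_zero_left (k : ℕ) (f : Ser ℂ) : leibniz p 0 (k + 1) f = 0 := by
  have : qBinom p 0 (k + 1) = 0 := Finset.prod_eq_zero (i := 0) (by simp) (by simp)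
  rw [leibniz, this, zero_smul]

/-- `P` has order at most `N`. -/
def OrdLE (P : PDO p) (N : ℤ) : Prop := ∀ i, N < i → P.coeff i = 0

theorem exists_ordLE (P : PDO p) : ∃ N, P.OrdLE N := P.bdd

theorem OrdLE.mono {P : PDO p} {N M : ℤ} (h : P.OrdLE N) (hNM : N ≤ M) : P.OrdLE M :=
  fun i hi => h i (lt_of_le_of_lt hNM hi)

/-- The product `D_p ^ i * Q`, `i ∈ ℤ`. -/
def dpow (i : ℤ) (Q : PDO p) : PDO p :=
  ⟨fun m => ∑ᶠ k : ℕ, leibniz p i k (Q.coeff (m - i + k)), by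
    obtain ⟨M, hM⟩ := Q.bdd
    refine ⟨i + M, fun m hm => finsum_eq_zero_of_forall_eq_zero fun k => ?_⟩
    rw [hM _ (by omega), leibniz_zero]⟩

theorem coeff_dpow (i : ℤ) (Q : PDO p) (m : ℤ) :
    (dpow i Q).coeff m = ∑ᶠ k : ℕ, leibniz p i k (Q.coeff (m - i + k)) := rfl

theorem OrdLE.dpow {Q : PDO p} {M : ℤ} (h : Q.OrdLE M) (i : ℤ) : (dpow i Q).OrdLE (i + M) :=
  fun m hm => finsum_eq_zero_of_forall_eq_zero fun k => by
    rw [h _ (by omega), leibniz_zero]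

theorem coeff_dpow_eq_sum {Q : PDO p} {M : ℤ} (h : Q.OrdLE M) (i m : ℤ) {K : ℕ}
    (hK : M - m + i < K) :
    (dpow i Q).coeff m = ∑ k ∈ Finset.range K, leibniz p i k (Q.coeff (m - i + k)) := by
  refine finsum_eq_sum_of_support_subset _ fun k hk => ?_
  rw [Finset.coe_range, Set.mem_Iio]
  by_contra hn
  exact hk (by
    simp only
    rw [h _ (by omega), leibniz_zero])

theorem coeff_mul (P Q : PDO p) (m : ℤ) :
    (P * Q).coeff m = ∑ᶠ i, P.coeff i * (dpow i Q).coeff m := by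
  change ∑ᶠ s : ℤ × ℕ, mulTerm P Q m s = _
  rw [finsum_curry _ (mulTerm_support_finite P Q m)]
  refine finsum_congr fun i => ?_
  rw [coeff_dpow, mul_finsum]
  rfl

/-- The ends `a` and `b` are left free so that different products can be summed over a common range.
-/
theorem coeff_mul_eq_sum {P Q : PDO p} {N M : ℤ} (hP : P.OrdLE N) (hQ : Q.OrdLE M) (m : ℤ)
    {a b : ℤ} (ha : a ≤ m - M) (hb : N ≤ b) :
    (P * Q).coeff m = ∑ i ∈ Finset.Icc a b, P.coeff i * (dpow i Q).coeff m := by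
  rw [coeff_mul]
  refine finsum_eq_sum_Icc (fun i hi => ?_) fun i hi => ?_
  · rw [hQ.dpow i m (by omega), mul_zero]
  · rw [hP i (by omega), zero_mul]

theorem OrdLE.mul {P Q : PDO p} {N M : ℤ} (hP : P.OrdLE N) (hQ : Q.OrdLE M) :
    (P * Q).OrdLE (N + M) := fun m hm => by
  rw [coeff_mul]
  refine finsum_eq_zero_of_forall_eq_zero fun i => ?_
  by_cases hi : N < i
  · rw [hP i hi, zero_mul]
  · rw [hQ.dpow i m (by omega), mul_zero]

instance : Zero (PDO p) := ⟨⟨fun _ => 0, 0, fun _ _ => rfl⟩⟩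

instance : Add (PDO p) := ⟨fun P Q => ⟨fun i => P.coeff i + Q.coeff i, by
  obtain ⟨N, hN⟩ := P.bdd
  obtain ⟨M, hM⟩ := Q.bdd
  exact ⟨max N M, fun i hi => by
    simp [hN i (lt_of_le_of_lt (le_max_left _ _) hi),
      hM i (lt_of_le_of_lt (le_max_right _ _) hi)]⟩⟩⟩

theorem coeff_zero (i : ℤ) : (0 : PDO p).coeff i = 0 := rfl

theorem coeff_add (P Q : PDO p) (i : ℤ) : (P + Q).coeff i = P.coeff i + Q.coeff i := rfl

theorem coeff_sub (P Q : PDO p) (i : ℤ) : (P - Q).coeff i = P.coeff i - Q.coeff i := rfl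

theorem coeff_one (i : ℤ) : (1 : PDO p).coeff i = if i = 0 then 1 else 0 := rfl

theorem dpow_add_right (i : ℤ) (Q R : PDO p) : dpow i (Q + R) = dpow i Q + dpow i R := by
  obtain ⟨M, hM⟩ := Q.exists_ordLE
  obtain ⟨M', hM'⟩ := R.exists_ordLE
  ext1
  funext m
  have h : ∀ T : PDO p, T.OrdLE (max M M') → (dpow i T).coeff m =
      ∑ k ∈ Finset.range ((max M M' - m + i).toNat + 1), leibniz p i k (T.coeff (m - i + k)) :=
    fun T hT => coeff_dpow_eq_sum hT i m (by omega)
  rw [coeff_add, h Q (hM.mono (le_max_left _ _)), h R (hM'.mono (le_max_right _ _)), h,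
    ← Finset.sum_add_distrib]
  · simp only [coeff_add, leibniz_add]
  · intro j hj
    rw [coeff_add, hM j (by omega), hM' j (by omega), add_zero]

/-- `D_p * D_p ^ i = D_p ^ (i + 1)`, in terms of coefficients. -/
theorem coeff_dpow_add_one (hp : Generic p) (i : ℤ) (Q : PDO p) (m : ℤ) :
    (dpow (i + 1) Q).coeff m =
      shift p 1 ((dpow i Q).coeff (m - 1)) + qD p ((dpow i Q).coeff m) := by
  obtain ⟨M, hM⟩ := Q.exists_ordLE
  set K := (M - m + i + 2).toNat with hK
  rw [coeff_dpow_eq_sum hM (i + 1) m (K := K + 1) (by omega),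
    coeff_dpow_eq_sum hM i (m - 1) (K := K + 1) (by omega),
    coeff_dpow_eq_sum hM i m (K := K) (by omega)]
  change _ = shiftHom p 1 _ + qDHom p _
  rw [map_sum, map_sum, Finset.sum_range_succ', Finset.sum_range_succ' _ K, add_right_comm,
    ← Finset.sum_add_distrib]
  congr 1
  · refine Finset.sum_congr rfl fun k _ => ?_
    rw [leibniz_succ_succ hp]
    have e1 : m - (i + 1) + ((k + 1 : ℕ) : ℤ) = m - i + k := by push_cast; ring
    have e2 : m - 1 - i + ((k + 1 : ℕ) : ℤ) = m - i + k := by push_cast; ring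
    rw [e1, e2]
    rfl
  · change _ = shift p 1 _
    rw [leibniz_zero_right, leibniz_zero_right, shift_shift hp.ne_zero, add_comm 1 i]
    congr 2
    push_cast
    ring

theorem dpow_zero (Q : PDO p) : dpow 0 Q = Q := by
  ext1
  funext m
  rw [coeff_dpow, finsum_eq_single _ 0]
  · rw [leibniz_zero_right, shift_zero_left]
    simp
  · intro k hk
    obtain ⟨k, rfl⟩ := Nat.exists_eq_succ_of_ne_zero hk
    exact leibniz_zero_left k _

theorem coeff_dpow_one (hp : Generic p) (Q : PDO p) (m : ℤ) :
    (dpow 1 Q).coeff m = shift p 1 (Q.coeff (m - 1)) + qD p (Q.coeff m) := by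
  have := coeff_dpow_add_one hp 0 Q m
  rwa [zero_add, dpow_zero] at this

theorem dpow_one_dpow (hp : Generic p) (i : ℤ) (Q : PDO p) :
    dpow 1 (dpow i Q) = dpow (i + 1) Q := by
  ext1
  funext m
  rw [coeff_dpow_add_one hp, coeff_dpow_one hp]

/-- The coefficient of `D_p^(m+1)` in `D_p Q` is `Q_m(p x) + D_p Q_(m+1)`, so the coefficients of
`Q` are recovered from the top downwards. This cancellation gives access to negative powers of
`D_p`. -/
theorem dpow_one_injective (hp : Generic p) : Function.Injective (dpow 1 : PDO p → PDO p) := by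
  intro P Q h
  obtain ⟨N, hN⟩ := P.exists_ordLE
  obtain ⟨M, hM⟩ := Q.exists_ordLE
  have key : ∀ (n : ℕ) (m : ℤ), max N M - n < m → P.coeff m = Q.coeff m := by
    intro n
    induction n with
    | zero =>
      intro m hm
      rw [hN m (by omega), hM m (by omega)]
    | succ n ih =>
      intro m hm
      have h1 := congrArg (fun T => T.coeff (m + 1)) h
      simp only [coeff_dpow_one hp, add_sub_cancel_right] at h1
      rw [ih (m + 1) (by push_cast at hm; omega)] at h1
      exact shift_injective hp.ne_zero 1 (add_right_cancel h1)
  ext1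
  funext m
  exact key (max N M - m + 1).toNat m (by omega)

/-- To prove an identity for all `D_p ^ i` it suffices to prove it for `D_p`. -/
theorem dpow_intertwine (hp : Generic p) {F : PDO p → PDO p}
    (hF : ∀ Q, F (dpow 1 Q) = dpow 1 (F Q)) (i : ℤ) (Q : PDO p) : F (dpow i Q) = dpow i (F Q) := by
  induction i with
  | zero => rw [dpow_zero, dpow_zero]
  | succ i ih => rw [← dpow_one_dpow hp, hF, ih, dpow_one_dpow hp]
  | pred i ih =>
    apply dpow_one_injective hp
    rw [← hF, dpow_one_dpow hp, dpow_one_dpow hp, sub_add_cancel, ih]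

theorem dpow_one_mul (hp : Generic p) (Q R : PDO p) : dpow 1 Q * R = dpow 1 (Q * R) := by
  obtain ⟨N, hN⟩ := Q.exists_ordLE
  obtain ⟨M, hM⟩ := R.exists_ordLE
  have z1 : ∀ i, shift p 1 (0 : Ser ℂ) * i = 0 := fun i => by rw [shift_zero, zero_mul]
  have z2 : ∀ i, qD p (0 : Ser ℂ) * i = 0 := fun i => by rw [qD_zero, zero_mul]
  ext1
  funext m
  rw [coeff_dpow_one hp, coeff_mul_eq_sum hN hM (m - 1) (a := m - 1 - M) (b := N + 1) le_rfl
    (by omega), coeff_mul_eq_sum hN hM m (a := m - 1 - M) (b := N + 1) (by omega) (by omega),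
    coeff_mul]
  change _ = shiftHom p 1 _ + qDHom p _
  rw [map_sum, map_sum, ← Finset.sum_add_distrib]
  have h1 : ∀ i ∈ Finset.Icc (m - 1 - M) (N + 1),
      shiftHom p 1 (Q.coeff i * (dpow i R).coeff (m - 1)) +
        qDHom p (Q.coeff i * (dpow i R).coeff m) =
      shift p 1 (Q.coeff i) * (dpow (i + 1) R).coeff m + qD p (Q.coeff i) * (dpow i R).coeff m := by
    intro i _
    change shift p 1 _ + qD p _ = _
    rw [shift_mul hp.ne_zero, qD_mul hp, coeff_dpow_add_one hp]
    ring
  rw [Finset.sum_congr rfl h1, Finset.sum_add_distrib]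
  simp only [coeff_dpow_one hp, add_mul]
  rw [finsum_add_distrib]
  · congr 1
    -- The dilated part of `D_p Q` carries `Q_(i-1)` at power `i`; reindexing lines it up with the
    -- term `D_p^(i+1) R`.
    · rw [← finsum_comp_equiv (Equiv.addRight (1 : ℤ))]
      simp only [Equiv.coe_addRight, add_sub_cancel_right]
      refine finsum_eq_sum_Icc (fun i hi => ?_) fun i hi => ?_
      · rw [hM.dpow (i + 1) m (by omega), mul_zero]
      · rw [hN i (by omega), z1]
    · refine finsum_eq_sum_Icc (fun i hi => ?_) fun i hi => ?_
      · rw [hM.dpow i m (by omega), mul_zero]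
      · rw [hN i (by omega), z2]
  · refine finite_support_of_bounds (m - M) (N + 1) (fun i hi => ?_) fun i hi => ?_
    · rw [hM.dpow i m (by omega), mul_zero]
    · rw [hN (i - 1) (by omega), z1]
  · refine finite_support_of_bounds (m - M) (N + 1) (fun i hi => ?_) fun i hi => ?_
    · rw [hM.dpow i m (by omega), mul_zero]
    · rw [hN i (by omega), z2]

theorem dpow_mul (hp : Generic p) (i : ℤ) (Q R : PDO p) : dpow i Q * R = dpow i (Q * R) :=
  dpow_intertwine hp (F := fun Q => Q * R) (fun Q => dpow_one_mul hp Q R) i Q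

/-- Expanding `P = ∑ P_i D_p^i` leaves only `(D_p^i Q) R = D_p^i (Q R)`, which is `dpow_mul`. -/
protected theorem mul_assoc' (hp : Generic p) (P Q R : PDO p) : P * Q * R = P * (Q * R) := by
  obtain ⟨N, hN⟩ := P.exists_ordLE
  obtain ⟨M, hM⟩ := Q.exists_ordLE
  obtain ⟨K, hK⟩ := R.exists_ordLE
  ext1
  funext m
  rw [coeff_mul_eq_sum (hN.mul hM) hK m (a := m - K) (b := N + M) le_rfl le_rfl,
    coeff_mul_eq_sum hN (hM.mul hK) m (a := m - (M + K)) (b := N) le_rfl le_rfl]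
  have h1 : ∀ j ∈ Finset.Icc (m - K) (N + M), (P * Q).coeff j * (dpow j R).coeff m =
      ∑ i ∈ Finset.Icc (m - (M + K)) N, P.coeff i * (dpow i Q).coeff j * (dpow j R).coeff m := by
    intro j hj
    rw [Finset.mem_Icc] at hj
    rw [coeff_mul_eq_sum hN hM j (a := m - (M + K)) (b := N) (by omega) le_rfl, Finset.sum_mul]
  rw [Finset.sum_congr rfl h1, Finset.sum_comm]
  refine Finset.sum_congr rfl fun i hi => ?_
  rw [Finset.mem_Icc] at hi
  rw [← dpow_mul hp, coeff_mul_eq_sum (hM.dpow i) hK m (a := m - K) (b := N + M) le_rfl (by omega),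
    Finset.mul_sum]
  simp only [mul_assoc]

protected theorem mul_add' (P Q R : PDO p) : P * (Q + R) = P * Q + P * R := by
  obtain ⟨N, hN⟩ := P.exists_ordLE
  obtain ⟨M, hM⟩ := Q.exists_ordLE
  obtain ⟨K, hK⟩ := R.exists_ordLE
  ext1
  funext m
  rw [coeff_add, coeff_mul, coeff_mul, coeff_mul, ← finsum_add_distrib]
  · simp only [dpow_add_right, coeff_add, mul_add]
  · refine finite_support_of_bounds (m - M) N (fun i hi => ?_) fun i hi => ?_
    · rw [hM.dpow i m (by omega), mul_zero]
    · rw [hN i hi, zero_mul]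
  · refine finite_support_of_bounds (m - K) N (fun i hi => ?_) fun i hi => ?_
    · rw [hK.dpow i m (by omega), mul_zero]
    · rw [hN i hi, zero_mul]

protected theorem add_mul' (P Q R : PDO p) : (P + Q) * R = P * R + Q * R := by
  obtain ⟨N, hN⟩ := P.exists_ordLE
  obtain ⟨M, hM⟩ := Q.exists_ordLE
  obtain ⟨K, hK⟩ := R.exists_ordLE
  ext1
  funext m
  rw [coeff_add, coeff_mul, coeff_mul, coeff_mul, ← finsum_add_distrib]
  · simp only [coeff_add, add_mul]
  · refine finite_support_of_bounds (m - K) N (fun i hi => ?_) fun i hi => ?_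
    · rw [hK.dpow i m (by omega), mul_zero]
    · rw [hN i hi, zero_mul]
  · refine finite_support_of_bounds (m - K) M (fun i hi => ?_) fun i hi => ?_
    · rw [hK.dpow i m (by omega), mul_zero]
    · rw [hM i hi, zero_mul]

protected theorem one_mul' (P : PDO p) : 1 * P = P := by
  ext1
  funext m
  rw [coeff_mul, finsum_eq_single _ 0]
  · rw [dpow_zero, coeff_one, if_pos rfl, one_mul]
  · intro i hi
    rw [coeff_one, if_neg hi, zero_mul]

theorem leibniz_succ_one (i : ℤ) (k : ℕ) : leibniz p i (k + 1) 1 = 0 := by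
  have h : (qD p)^[k] (0 : Ser ℂ) = 0 := Function.iterate_fixed qD_zero k
  rw [leibniz, Function.iterate_succ_apply, qD_one, h, shift_zero, smul_zero]

/-- The operator `D_p ^ j`, `j ∈ ℤ`. -/
def Dz (p : ℂ) (j : ℤ) : PDO p := ⟨fun i => if i = j then 1 else 0, j, fun _ hi => if_neg hi.ne'⟩

theorem coeff_Dz (j i : ℤ) : (Dz p j).coeff i = if i = j then 1 else 0 := rfl

theorem dpow_Dz (i j : ℤ) : dpow i (Dz p j) = Dz p (i + j) := by
  ext1
  funext m
  rw [coeff_dpow, finsum_eq_single _ 0]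
  · rw [leibniz_zero_right, coeff_Dz, coeff_Dz]
    split_ifs with h1 h2 h2
    · exact shift_one _
    · push_cast at h1; omega
    · push_cast at h1; omega
    · exact shift_zero _ _
  · intro k hk
    obtain ⟨k, rfl⟩ := Nat.exists_eq_succ_of_ne_zero hk
    rw [coeff_Dz]
    split_ifs
    · exact leibniz_succ_one i k
    · exact leibniz_zero _ _

theorem coeff_mul_Dz (P : PDO p) (j m : ℤ) : (P * Dz p j).coeff m = P.coeff (m - j) := by
  rw [coeff_mul, finsum_eq_single _ (m - j)]
  · rw [dpow_Dz, coeff_Dz, if_pos (by ring), mul_one]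
  · intro i hi
    rw [dpow_Dz, coeff_Dz, if_neg (by omega), mul_zero]

theorem coeff_mul_D (P : PDO p) (m : ℤ) : (P * D p).coeff m = P.coeff (m - 1) :=
  coeff_mul_Dz P 1 m

protected theorem mul_one' (P : PDO p) : P * 1 = P := by
  ext1
  funext m
  have := coeff_mul_Dz P 0 m
  rwa [sub_zero] at this

instance : AddCommGroup (PDO p) where
  add_assoc P Q R := by ext1; funext i; exact add_assoc _ _ _
  zero_add P := by ext1; funext i; exact zero_add _
  add_zero P := by ext1; funext i; exact add_zero _
  add_comm P Q := by ext1; funext i; exact add_comm _ _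
  neg_add_cancel P := by ext1; funext i; exact neg_add_cancel _
  sub_eq_add_neg P Q := by ext1; funext i; exact sub_eq_add_neg _ _
  nsmul := nsmulRec
  zsmul := zsmulRec

instance [hp : Fact (Generic p)] : Ring (PDO p) where
  __ := (inferInstance : AddCommGroup (PDO p))
  mul_assoc := PDO.mul_assoc' hp.out
  one_mul := PDO.one_mul'
  mul_one := PDO.mul_one'
  left_distrib := PDO.mul_add'
  right_distrib := PDO.add_mul'
  zero_mul P := by
    ext1
    funext m
    rw [coeff_mul]
    exact finsum_eq_zero_of_forall_eq_zero fun i => by rw [coeff_zero, zero_mul]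
  mul_zero P := by
    have h := PDO.mul_add' P 0 0
    rw [add_zero] at h
    exact left_eq_add.mp h

/-- Extraction of a coefficient as an additive map. -/
def coeffHom (i : ℤ) : PDO p →+ Ser ℂ where
  toFun P := P.coeff i
  map_zero' := rfl
  map_add' _ _ := rfl

theorem coeff_sum {ι : Type} (s : Finset ι) (P : ι → PDO p) (i : ℤ) :
    (∑ k ∈ s, P k).coeff i = ∑ k ∈ s, (P k).coeff i :=
  map_sum (coeffHom i) P s

theorem ordLE_one : (1 : PDO p).OrdLE 0 := fun _ hi => if_neg hi.ne'

theorem IsMonic.ordLE_one_sub {P : PDO p} (h : P.IsMonic) : (1 - P).OrdLE (-1) := by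
  intro i hi
  rw [coeff_sub, coeff_one]
  rcases (show 0 ≤ i by omega).eq_or_lt with h0 | h0
  · rw [← h0, if_pos rfl, h.1, sub_self]
  · rw [if_neg h0.ne', h.2 i h0, sub_self]

/-- A coefficient of a product depends on finitely many coefficients of the second factor. -/
theorem coeff_mul_congr {P Q R : PDO p} {N m : ℤ} (hP : P.OrdLE N)
    (h : ∀ j, m - N ≤ j → Q.coeff j = R.coeff j) : (P * Q).coeff m = (P * R).coeff m := by
  rw [coeff_mul, coeff_mul]
  refine finsum_congr fun i => ?_
  by_cases hi : N < i
  · rw [hP i hi, zero_mul, zero_mul]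
  · rw [coeff_dpow, coeff_dpow]
    congr 1
    refine finsum_congr fun k => ?_
    rw [h _ (by omega)]

/-! ### Inverses of monic operators -/

variable [Fact (Generic p)]

theorem power_eq_pow (P : PDO p) (k : ℕ) : power P k = P ^ k := by
  induction k with
  | zero => exact (pow_zero P).symm
  | succ k ih => rw [pow_succ', ← ih]; rfl

theorem OrdLE.pow {P : PDO p} {N : ℤ} (h : P.OrdLE N) (k : ℕ) : (P ^ k).OrdLE (k * N) := by
  induction k with
  | zero => simpa using ordLE_one
  | succ k ih =>
    rw [pow_succ]
    convert ih.mul h using 1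
    push_cast
    ring

/-- Since `(1 - P)^k` has order at most `-k`, lengthening the truncation of the geometric series
does not change the coefficient. -/
theorem IsMonic.coeff_inv {P : PDO p} (h : P.IsMonic) {i : ℤ} {K : ℕ} (hK : -i < K) :
    P.inv.coeff i = (∑ k ∈ Finset.range K, (1 - P) ^ k).coeff i := by
  have hz : ∀ k : ℕ, -i < k → ((1 - P) ^ k).coeff i = 0 := fun k hk =>
    h.ordLE_one_sub.pow k i (by omega)
  change (if i ≤ 0 then _ else _) = _
  rw [coeff_sum]
  split_ifs with hi
  · simp only [power_eq_pow]
    refine Finset.sum_subset (fun k hk => ?_) fun k _ hk => hz k ?_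
    · rw [Finset.mem_range] at *
      omega
    · rw [Finset.mem_range] at hk
      omega
  · exact (Finset.sum_eq_zero fun k _ => hz k (by omega)).symm

theorem IsMonic.mul_inv {P : PDO p} (h : P.IsMonic) : P * P.inv = 1 := by
  -- Multiplying the geometric series by `1 - P` drops its term `k = 0`; in each coefficient this is
  -- checked on truncations of lengths `K` and `K + 1`.
  have key : (1 - P) * P.inv = P.inv - 1 := by
    ext1
    funext m
    obtain ⟨K, hK⟩ : ∃ K : ℕ, -m < K := ⟨(-m).toNat + 1, by omega⟩
    rw [coeff_mul_congr h.ordLE_one_sub (R := ∑ k ∈ Finset.range K, (1 - P) ^ k)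
      fun j hj => h.coeff_inv (by omega), coeff_sub, h.coeff_inv (K := K + 1) (by omega),
      Finset.sum_range_succ' _ K, pow_zero, ← coeff_sub, add_sub_cancel_right, Finset.mul_sum]
    simp only [pow_succ']
  rw [sub_mul, one_mul] at key
  exact sub_right_injective key

theorem IsMonic.inv {P : PDO p} (h : P.IsMonic) : P.inv.IsMonic := by
  constructor
  · rw [h.coeff_inv (K := 1) (by simp)]
    simp [coeff_one]
  · intro i hi
    exact if_neg (not_le.mpr hi)

theorem IsMonic.inv_mul {P : PDO p} (h : P.IsMonic) : P.inv * P = 1 := by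
  have h1 := h.mul_inv
  have h2 := h.inv.mul_inv
  -- `P.inv` has the left inverse `P` and the right inverse `P.inv.inv`, so these coincide.
  rwa [← left_inv_eq_right_inv h1 h2] at h2

end PDO

/-! ### Adjoints and the residue pairing -/

namespace PDO

variable {q : ℂ}

instance [hq : Fact (Generic q)] : Fact (Generic q⁻¹) := ⟨hq.out.inv⟩

theorem qD_inv_iterate (hq : Generic q) (k : ℕ) (f : Ser ℂ) :
    (qD q⁻¹)^[k] f = (∏ l ∈ Finset.range k, (q ^ l)⁻¹) • shift q (-k) ((qD q)^[k] f) := by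
  induction k with
  | zero => simp [shift_zero_left]
  | succ k ih =>
    rw [Function.iterate_succ_apply', ih, Function.iterate_succ_apply', qD_smul, qD_inv hq,
      qD_shift hq.ne_zero, shift_smul, shift_shift hq.ne_zero, smul_smul, Finset.prod_range_succ]
    congr 2
    · rw [zpow_neg, zpow_natCast]
    · push_cast
      ring

/-- The numerators are the same factors in reverse order; the sign and the powers of `q` come from
`1 - q^(-(l+1)) = -(1 - q^(l+1)) q^(-(l+1))` in the denominators. -/
theorem qBinom_reflect (hq : Generic q) (i : ℤ) (k : ℕ) :
    qBinom q i k = (-q) ^ (-k : ℤ) * (qBinom q⁻¹ (k - 1 - i) k *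
      ∏ l ∈ Finset.range k, (q ^ l)⁻¹) := by
  have h1 : ((-q) ^ (-k : ℤ) : ℂ) = ∏ l ∈ Finset.range k, (-q)⁻¹ := by
    rw [Finset.prod_const, Finset.card_range, zpow_neg, zpow_natCast, inv_pow]
  have h2 : qBinom q⁻¹ (k - 1 - i) k = (∏ l ∈ Finset.range k, (1 - q ^ (i - l))) /
      ∏ l ∈ Finset.range k, (1 - q⁻¹ ^ (l + 1)) := by
    rw [qBinom, Finset.prod_div_distrib]
    congr 1
    rw [← Finset.prod_range_reflect]
    refine Finset.prod_congr rfl fun l hl => ?_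
    rw [Finset.mem_range] at hl
    rw [inv_zpow', Nat.sub_sub, Nat.cast_sub (by omega)]
    congr 2
    push_cast
    ring
  rw [h1, h2, ← Finset.prod_div_distrib, ← Finset.prod_mul_distrib, ← Finset.prod_mul_distrib,
    qBinom]
  refine Finset.prod_congr rfl fun l _ => ?_
  have h3 := hq.one_sub_ne_zero l
  have h0 := hq.ne_zero
  have h4 : 1 - q⁻¹ ^ (l + 1) = -(1 - q ^ (l + 1)) * (q ^ (l + 1))⁻¹ := by
    rw [inv_pow]
    field_simp
    ring
  rw [h4]
  field_simp
  ring

/-- The two orders of moving a function through powers of `D_q` and of `D_{1/q}`. -/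
theorem leibniz_reflect (hq : Generic q) (i : ℤ) (k : ℕ) (f : Ser ℂ) :
    leibniz q i k f = (-q) ^ (-k : ℤ) • shift q (-1) (leibniz q⁻¹ (k - 1 - i) k f) := by
  rw [leibniz, leibniz, qD_inv_iterate hq, shift_inv, shift_smul, shift_smul, shift_smul,
    shift_shift hq.ne_zero, shift_shift hq.ne_zero, smul_smul, smul_smul, qBinom_reflect hq i k,
    mul_assoc]
  congr 2
  ring

theorem OrdLE.adjoint {Q : PDO q} {M : ℤ} (h : Q.OrdLE M) : Q.adjoint.OrdLE M := fun m hm =>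
  finsum_eq_zero_of_forall_eq_zero fun k => by rw [h _ (by omega), leibniz_zero, smul_zero]

/-- The operator `D_{1/q} ^ j * Q^*`, expanded from `Q^* = ∑ l, (-1/q) ^ l D_{1/q} ^ l ∘ Q_l`. -/
def dpowAdjoint (j : ℤ) (Q : PDO q) : PDO q⁻¹ :=
  ⟨fun m => ∑ᶠ k : ℕ, ((-q⁻¹) ^ (m - j + k)) • leibniz q⁻¹ (m + k) k (Q.coeff (m - j + k)), by
    obtain ⟨N, hN⟩ := Q.bdd
    refine ⟨N + j, fun m hm => finsum_eq_zero_of_forall_eq_zero fun k => ?_⟩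
    rw [hN _ (by omega), leibniz_zero, smul_zero]⟩

theorem coeff_dpowAdjoint {Q : PDO q} {M : ℤ} (h : Q.OrdLE M) (j m : ℤ) {K : ℕ}
    (hK : M - m + j < K) :
    (dpowAdjoint j Q).coeff m = ∑ k ∈ Finset.range K,
      ((-q⁻¹) ^ (m - j + k)) • leibniz q⁻¹ (m + k) k (Q.coeff (m - j + k)) := by
  refine finsum_eq_sum_of_support_subset _ fun k hk => ?_
  rw [Finset.coe_range, Set.mem_Iio]
  by_contra hn
  exact hk (by
    simp only
    rw [h _ (by omega), leibniz_zero, smul_zero])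

theorem dpow_one_dpowAdjoint (hq : Generic q) (j : ℤ) (Q : PDO q) :
    dpow 1 (dpowAdjoint j Q) = dpowAdjoint (j + 1) Q := by
  obtain ⟨M, hM⟩ := Q.exists_ordLE
  ext1
  funext m
  set K := (M - m + j + 2).toNat with hK
  rw [coeff_dpow_one hq.inv, coeff_dpowAdjoint hM (j + 1) m (K := K + 1) (by omega),
    coeff_dpowAdjoint hM j (m - 1) (K := K + 1) (by omega),
    coeff_dpowAdjoint hM j m (K := K) (by omega)]
  change shiftHom q⁻¹ 1 _ + qDHom q⁻¹ _ = _
  rw [map_sum, map_sum, Finset.sum_range_succ', Finset.sum_range_succ' _ K, add_right_comm,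
    ← Finset.sum_add_distrib]
  congr 1
  · refine Finset.sum_congr rfl fun k _ => ?_
    rw [map_smul, map_smul]
    have e1 : m - (j + 1) + ((k + 1 : ℕ) : ℤ) = m - j + k := by push_cast; ring
    have e2 : m - 1 - j + ((k + 1 : ℕ) : ℤ) = m - j + k := by push_cast; ring
    have e3 : m - 1 + ((k + 1 : ℕ) : ℤ) = m + k := by push_cast; ring
    have e4 : m + ((k + 1 : ℕ) : ℤ) = m + k + 1 := by push_cast; ring
    rw [e1, e2, e3, e4, leibniz_succ_succ hq.inv, smul_add]
    rfl
  · rw [map_smul]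
    change _ • shift q⁻¹ 1 _ = _
    have e1 : m - 1 - j + ((0 : ℕ) : ℤ) = m - (j + 1) + ((0 : ℕ) : ℤ) := by ring
    have e2 : 1 + (m - 1 + ((0 : ℕ) : ℤ)) = m + ((0 : ℕ) : ℤ) := by ring
    rw [leibniz_zero_right, leibniz_zero_right, shift_shift hq.inv.ne_zero, e1, e2]

/-- Both sides agree at `j = 0` and obey the same recursion in `j`. This turns a composition of two
Leibniz expansions into a single sum. -/
theorem dpow_adjoint (hq : Generic q) (j : ℤ) (Q : PDO q) :
    dpow j Q.adjoint = dpowAdjoint j Q := by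
  induction j with
  | zero =>
    rw [dpow_zero]
    ext1
    funext m
    simp [dpowAdjoint, adjoint]
  | succ i ih => rw [← dpow_one_dpow hq.inv, ih, dpow_one_dpowAdjoint hq]
  | pred i ih =>
    apply dpow_one_injective hq.inv
    rw [dpow_one_dpow hq.inv, dpow_one_dpowAdjoint hq, sub_add_cancel, ih]

/-- This is `pairing_mul` for `P = D_q^i` and `V = D_{1/q}^j`; the two sums agree term by term by
`leibniz_reflect`. -/
theorem coeff_dpow_adjoint (hq : Generic q) (i j : ℤ) (Q : PDO q) :
    (-q) ^ j • (dpow i Q).coeff (-1 - j) =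
      (-q) ^ (-1 - i) • shift q (-1) ((dpow j Q.adjoint).coeff (-1 - i)) := by
  obtain ⟨M, hM⟩ := Q.exists_ordLE
  have h0 : -q ≠ 0 := neg_ne_zero.mpr hq.ne_zero
  set K := (M + 1 + i + j).toNat + 1 with hK
  rw [dpow_adjoint hq, coeff_dpow_eq_sum hM i (-1 - j) (K := K) (by omega),
    coeff_dpowAdjoint hM j (-1 - i) (K := K) (by omega)]
  change _ = _ • shiftHom q (-1) _
  rw [map_sum, Finset.smul_sum, Finset.smul_sum]
  refine Finset.sum_congr rfl fun k _ => ?_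
  rw [map_smul]
  change _ = _ • _ • shift q (-1) _
  rw [leibniz_reflect hq]
  have e1 : -1 - j - i + (k : ℤ) = -1 - i - j + k := by ring
  have e2 : (k : ℤ) - 1 - i = -1 - i + k := by ring
  have e3 : (-q⁻¹) ^ (-1 - i - j + (k : ℤ)) = (-q) ^ (1 + i + j - (k : ℤ)) := by
    rw [← inv_neg, inv_zpow']
    congr 1
    ring
  rw [e1, e2, e3, smul_smul, smul_smul, ← zpow_add₀ h0, ← zpow_add₀ h0]
  congr 2
  ring

/-- The residue of `(P e_q(x z)) * (V_{x/q} e_{1/q}(-x z))` in `z`, in terms of coefficients. -/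
def pairing (P : PDO q) (V : PDO q⁻¹) : Ser ℂ :=
  ∑ᶠ i, P.coeff i * ((-q) ^ (-1 - i) • shift q (-1) (V.coeff (-1 - i)))

theorem pairing_eq_sum {P : PDO q} {V : PDO q⁻¹} {N K : ℤ} (hP : P.OrdLE N) (hV : V.OrdLE K)
    {a b : ℤ} (ha : a ≤ -1 - K) (hb : N ≤ b) :
    pairing P V = ∑ i ∈ Finset.Icc a b,
      P.coeff i * ((-q) ^ (-1 - i) • shift q (-1) (V.coeff (-1 - i))) := by
  refine finsum_eq_sum_Icc (fun i hi => ?_) fun i hi => ?_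
  · rw [hV _ (by omega), shift_zero, smul_zero, mul_zero]
  · rw [hP i (by omega), zero_mul]

theorem pairing_eq_sum' {P : PDO q} {V : PDO q⁻¹} {N K : ℤ} (hP : P.OrdLE N) (hV : V.OrdLE K)
    {a b : ℤ} (ha : a ≤ -1 - N) (hb : K ≤ b) :
    pairing P V = ∑ j ∈ Finset.Icc a b,
      P.coeff (-1 - j) * ((-q) ^ j • shift q (-1) (V.coeff j)) := by
  rw [pairing, ← finsum_comp_equiv (Equiv.subLeft (-1 : ℤ))]
  simp only [Equiv.subLeft_apply, sub_sub_cancel]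
  refine finsum_eq_sum_Icc (fun i hi => ?_) fun i hi => ?_
  · rw [hP _ (by omega), zero_mul]
  · rw [hV i (by omega), shift_zero, smul_zero, mul_zero]

theorem pairing_one (P : PDO q) : pairing P 1 = P.coeff (-1) := by
  rw [pairing, finsum_eq_single _ (-1)]
  · simp [coeff_one, shift_one]
  · intro i hi
    rw [coeff_one, if_neg (by omega), shift_zero, smul_zero, mul_zero]

/-- Right multiplication is adjoint to right multiplication by the formal adjoint. -/
theorem pairing_mul (hq : Generic q) (P Q : PDO q) (V : PDO q⁻¹) :
    pairing (P * Q) V = pairing P (V * Q.adjoint) := by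
  obtain ⟨N, hN⟩ := P.exists_ordLE
  obtain ⟨M, hM⟩ := Q.exists_ordLE
  obtain ⟨K, hK⟩ := V.exists_ordLE
  -- The left side is summed over the powers in `V` and the right side over those in `P`, so that
  -- expanding the products yields the same double sum.
  rw [pairing_eq_sum' (hN.mul hM) hK (a := -1 - (N + M)) (b := K) le_rfl le_rfl,
    pairing_eq_sum hN (hK.mul hM.adjoint) (a := -1 - (K + M)) (b := N) le_rfl le_rfl]
  have h1 : ∀ j ∈ Finset.Icc (-1 - (N + M)) K,
      (P * Q).coeff (-1 - j) * ((-q) ^ j • shift q (-1) (V.coeff j)) =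
      ∑ i ∈ Finset.Icc (-1 - (K + M)) N, P.coeff i *
        ((-q) ^ j • (dpow i Q).coeff (-1 - j)) * shift q (-1) (V.coeff j) := by
    intro j hj
    rw [Finset.mem_Icc] at hj
    rw [coeff_mul_eq_sum hN hM (-1 - j) (a := -1 - (K + M)) (b := N) (by omega) le_rfl,
      Finset.sum_mul]
    refine Finset.sum_congr rfl fun i _ => ?_
    simp only [mul_smul_comm, smul_mul_assoc]
  have h2 : ∀ i ∈ Finset.Icc (-1 - (K + M)) N,
      P.coeff i * ((-q) ^ (-1 - i) • shift q (-1) ((V * Q.adjoint).coeff (-1 - i))) =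
      ∑ j ∈ Finset.Icc (-1 - (N + M)) K, P.coeff i *
        ((-q) ^ (-1 - i) • shift q (-1) ((dpow j Q.adjoint).coeff (-1 - i))) *
          shift q (-1) (V.coeff j) := by
    intro i hi
    rw [Finset.mem_Icc] at hi
    rw [coeff_mul_eq_sum hK hM.adjoint (-1 - i) (a := -1 - (N + M)) (b := K) (by omega) le_rfl]
    change _ * _ • shiftHom q (-1) _ = _
    rw [map_sum, Finset.smul_sum, Finset.mul_sum]
    refine Finset.sum_congr rfl fun j _ => ?_
    change _ * _ • shift q (-1) _ = _
    rw [shift_mul hq.ne_zero, mul_assoc, smul_mul_assoc, mul_comm (shift q (-1) (V.coeff j))]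
  rw [Finset.sum_congr rfl h1, Finset.sum_congr rfl h2, Finset.sum_comm]
  refine Finset.sum_congr rfl fun i _ => Finset.sum_congr rfl fun j _ => ?_
  rw [coeff_dpow_adjoint hq]

theorem IsMonic.ordLE {P : PDO q} (h : P.IsMonic) : P.OrdLE 0 := h.2

theorem IsMonic.adjoint {P : PDO q} (h : P.IsMonic) : P.adjoint.IsMonic := by
  refine ⟨?_, h.ordLE.adjoint⟩
  change ∑ᶠ k : ℕ, _ = _
  rw [finsum_eq_single _ 0]
  · rw [leibniz_zero_right]
    simp [h.1, shift_one]
  · intro k hk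
    rw [h.2 _ (by omega), leibniz_zero, smul_zero]

/-- The pairing of `B S` with `(S^*)⁻¹` vanishes for every differential operator `B`. -/
theorem pairing_mul_adjoint_inv [hq : Fact (Generic q)] {B S : PDO q} (hS : S.IsMonic)
    (hB : B.coeff (-1) = 0) : pairing (B * S) S.adjoint.inv = 0 := by
  rw [pairing_mul hq.out, hS.adjoint.inv_mul, pairing_one, hB]

end PDO

open PDO

/-! ### Time derivatives and differential operators -/

section Derivatives

variable {p : ℂ}

/-- The derivative in a time as a linear map. -/
def dtHom (j : ℕ+) : Ser ℂ →ₗ[ℂ] Ser ℂ := (MvPowerSeries.pderiv ℂ (some j)).toLinearMap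

theorem dtHom_apply (j : ℕ+) (f : Ser ℂ) : dtHom j f = dt j f := rfl

theorem dt_zero (j : ℕ+) : dt j (0 : Ser ℂ) = 0 := (dtHom j).map_zero

theorem dt_smul (j : ℕ+) (c : ℂ) (f : Ser ℂ) : dt j (c • f) = c • dt j f := (dtHom j).map_smul c f

theorem dt_shift (j : ℕ+) (n : ℤ) (f : Ser ℂ) : dt j (shift p n f) = shift p n (dt j f) := by
  ext m
  simp only [coeff_dt, coeff_shift, smul_mul_assoc]
  simp

theorem dt_qD (j : ℕ+) (f : Ser ℂ) : dt j (qD p f) = qD p (dt j f) := by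
  ext m
  simp only [coeff_dt, coeff_qD, smul_mul_assoc]
  simp [add_right_comm]

theorem dt_leibniz (j : ℕ+) (i : ℤ) (k : ℕ) (f : Ser ℂ) :
    dt j (leibniz p i k f) = leibniz p i k (dt j f) := by
  have h : ∀ f, dt j ((qD p)^[k] f) = (qD p)^[k] (dt j f) :=
    Function.Semiconj.iterate_right (f := dt j) (ga := qD p) (gb := qD p) (dt_qD j) k
  rw [leibniz, dt_smul, dt_shift, h, leibniz]

namespace PDO

theorem coeff_tderiv (j : ℕ+) (P : PDO p) (i : ℤ) : (P.tderiv j).coeff i = dt j (P.coeff i) := rfl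

theorem OrdLE.tderiv {P : PDO p} {N : ℤ} (h : P.OrdLE N) (j : ℕ+) : (P.tderiv j).OrdLE N :=
  fun i hi => by rw [coeff_tderiv, h i hi, dt_zero]

theorem tderiv_dpow (j : ℕ+) (i : ℤ) (Q : PDO p) : (dpow i Q).tderiv j = dpow i (Q.tderiv j) := by
  obtain ⟨M, hM⟩ := Q.exists_ordLE
  ext1
  funext m
  rw [coeff_tderiv, coeff_dpow_eq_sum hM i m (K := (M - m + i).toNat + 1) (by omega),
    coeff_dpow_eq_sum (hM.tderiv j) i m (K := (M - m + i).toNat + 1) (by omega), ← dtHom_apply,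
    map_sum]
  exact Finset.sum_congr rfl fun k _ => dt_leibniz j i k _

/-- The Leibniz rule for the derivative in a time of a product of operators. -/
theorem tderiv_mul (j : ℕ+) (P Q : PDO p) :
    (P * Q).tderiv j = P * Q.tderiv j + P.tderiv j * Q := by
  obtain ⟨N, hN⟩ := P.exists_ordLE
  obtain ⟨M, hM⟩ := Q.exists_ordLE
  ext1
  funext m
  rw [coeff_tderiv, coeff_add, coeff_mul_eq_sum hN hM m le_rfl le_rfl,
    coeff_mul_eq_sum hN (hM.tderiv j) m le_rfl le_rfl,
    coeff_mul_eq_sum (hN.tderiv j) hM m le_rfl le_rfl, ← dtHom_apply, map_sum,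
    ← Finset.sum_add_distrib]
  refine Finset.sum_congr rfl fun i _ => ?_
  rw [dtHom_apply, dt_mul, ← tderiv_dpow, coeff_tderiv, coeff_tderiv]

/-- `P` is a differential operator: it has no negative powers of `D_p`. -/
def IsDifferential (P : PDO p) : Prop := ∀ i, i < 0 → P.coeff i = 0

theorem isDifferential_one : (1 : PDO p).IsDifferential := fun _ hi => if_neg hi.ne

theorem isDifferential_pos (P : PDO p) : P.pos.IsDifferential := fun _ hi => if_neg (not_le.mpr hi)

theorem IsDifferential.add {P Q : PDO p} (hP : P.IsDifferential) (hQ : Q.IsDifferential) :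
    (P + Q).IsDifferential := fun i hi => by rw [coeff_add, hP i hi, hQ i hi, add_zero]

theorem IsDifferential.tderiv {P : PDO p} (hP : P.IsDifferential) (j : ℕ+) :
    (P.tderiv j).IsDifferential := fun i hi => by rw [coeff_tderiv, hP i hi, dt_zero]

theorem IsDifferential.dpow_one (hp : Generic p) {P : PDO p} (hP : P.IsDifferential) :
    (dpow 1 P).IsDifferential := fun i hi => by
  rw [coeff_dpow_one hp, hP i hi, hP (i - 1) (by omega), shift_zero, qD_zero, add_zero]

theorem IsDifferential.mul (hp : Generic p) {P Q : PDO p} (hP : P.IsDifferential)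
    (hQ : Q.IsDifferential) : (P * Q).IsDifferential := fun m hm => by
  rw [coeff_mul]
  refine finsum_eq_zero_of_forall_eq_zero fun i => ?_
  by_cases hi : i < 0
  · rw [hP i hi, zero_mul]
  · have h : ∀ n : ℕ, (dpow n Q).IsDifferential := by
      intro n
      induction n with
      | zero => simpa [dpow_zero] using hQ
      | succ n ih =>
        rw [Nat.cast_succ, ← dpow_one_dpow hp]
        exact ih.dpow_one hp
    obtain ⟨n, rfl⟩ := Int.eq_ofNat_of_zero_le (not_lt.mp hi)
    rw [h n m hm, mul_zero]

theorem pos_add_neg (P : PDO p) : P.pos + P.neg = P := by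
  ext1
  funext i
  rw [coeff_add]
  simp only [pos, neg]
  split_ifs with h1 h2 h2
  · omega
  · exact add_zero _
  · exact zero_add _
  · omega

end PDO

end Derivatives

/-! ### Wave functions, symbols and the diagonal identity -/

section Symbols

variable {q : ℂ}

theorem coeff_symbol (c : ℂ) (P : PDO q) (m : Var →₀ ℕ) (k : ℤ) :
    (MvPowerSeries.coeff m (symbol c P)).coeff k = c ^ (-k) * MvPowerSeries.coeff m (P.coeff (-k)) :=
  rfl

theorem coeff_symbol_one (P : PDO q) (m : Var →₀ ℕ) (k : ℤ) :
    (MvPowerSeries.coeff m (symbol 1 P)).coeff k = MvPowerSeries.coeff m (P.coeff (-k)) := by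
  rw [coeff_symbol, one_zpow, one_mul]

theorem coeff_z_mul (a : ZSer) (k : ℤ) : (z * a).coeff k = a.coeff (k + 1) := by
  rw [z, HahnSeries.coeff_single_mul, one_mul, sub_neg_eq_add]

theorem coeff_algebraMap_mul (c : ℂ) (a : ZSer) (k : ℤ) :
    (algebraMap ℂ ZSer c * a).coeff k = c * a.coeff k := by
  have h : algebraMap ℂ ZSer c = HahnSeries.single 0 c := by
    rw [HahnSeries.algebraMap_apply']
    simp
  rw [h, HahnSeries.coeff_single_mul, sub_zero]

theorem symbol_add (P Q : PDO q) : symbol 1 (P + Q) = symbol 1 P + symbol 1 Q := by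
  ext m k
  rw [map_add, HahnSeries.coeff_add]
  simp only [coeff_symbol_one, coeff_add, map_add]

theorem symbol_dpow_one (hq : Generic q) (P : PDO q) :
    symbol 1 (dpow 1 P) =
      MvPowerSeries.C z * shift q 1 (symbol 1 P) + qD q (symbol 1 P) := by
  ext m k
  rw [map_add, HahnSeries.coeff_add, MvPowerSeries.coeff_C_mul, coeff_z_mul, coeff_symbol_one,
    coeff_dpow_one hq, map_add, coeff_shift, coeff_shift, coeff_qD, coeff_qD,
    Algebra.smul_def (A := ZSer), Algebra.smul_def (A := ZSer), coeff_algebraMap_mul,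
    coeff_algebraMap_mul, coeff_symbol_one, coeff_symbol_one, neg_add', smul_eq_mul, smul_eq_mul]

theorem symbol_tderiv (j : ℕ+) (P : PDO q) : symbol 1 (P.tderiv j) = dt j (symbol 1 P) := by
  ext m k
  rw [coeff_symbol_one, coeff_tderiv, coeff_dt, coeff_dt, ← Nat.cast_add_one, ← Nat.cast_add_one,
    mul_comm, ← nsmul_eq_mul, mul_comm, ← nsmul_eq_mul, HahnSeries.coeff_nsmul, Pi.smul_apply,
    coeff_symbol_one]

theorem symbol_mul_D (P : PDO q) : symbol 1 (P * D q) = MvPowerSeries.C z * symbol 1 P := by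
  ext m k
  rw [MvPowerSeries.coeff_C_mul, coeff_z_mul, coeff_symbol_one, coeff_symbol_one, coeff_mul_D,
    neg_add']

theorem symbol_mul_D_pow [Fact (Generic q)] (P : PDO q) (n : ℕ) :
    symbol 1 (P * D q ^ n) = MvPowerSeries.C (z ^ n) * symbol 1 P := by
  induction n with
  | zero => simp
  | succ n ih =>
    rw [pow_succ (D q), ← mul_assoc, symbol_mul_D, ih, ← mul_assoc, ← map_mul, ← pow_succ']

theorem wave_eq (P : PDO q) :
    wave P = symbol 1 P * qExp q z * expT fun i => z ^ (i : ℕ) := by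
  rw [wave, actExp, one_smul]

/-- By the twisted Leibniz rule, `e_q(xz)` contributes `z` times the dilated symbol, which together
with the `q`-derivative of the symbol is the symbol of `D_q P`. -/
theorem qD_wave (hq : Generic q) (P : PDO q) : qD q (wave P) = wave (dpow 1 P) := by
  rw [wave_eq, wave_eq, qD_mul hq, qD_expT, qD_mul hq, qD_qExp hq, symbol_dpow_one hq]
  ring

/-- The factor `z^j` produced by `e^ξ` corresponds to right multiplication by `D_q^j`. -/
theorem dt_wave [Fact (Generic q)] (j : ℕ+) (P : PDO q) :
    dt j (wave P) = wave (P.tderiv j + P * D q ^ (j : ℕ)) := by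
  rw [wave_eq, wave_eq, dt_mul, dt_expT, dt_mul, dt_qExp, symbol_add, symbol_tderiv,
    symbol_mul_D_pow]
  ring

theorem IsSolution.pow_mul [Fact (Generic q)] {L S : PDO q} (h : IsSolution L S) (n : ℕ) :
    L ^ n * S = S * D q ^ n := by
  induction n with
  | zero => rw [pow_zero, pow_zero, one_mul, mul_one]
  | succ n ih =>
    rw [pow_succ', mul_assoc, ih, h.gauge, mul_assoc, mul_assoc, ← mul_assoc S.inv,
      h.monic.inv_mul, one_mul, pow_succ']

/-- The linear evolution of the gauge operator: `∂_j S + S D_q ^ j = (L ^ j)_+ S`. -/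
theorem IsSolution.evolution [Fact (Generic q)] {L S : PDO q} (h : IsSolution L S) (j : ℕ+) :
    S.tderiv j + S * D q ^ (j : ℕ) = (L.power j).pos * S := by
  have h1 := pos_add_neg (L.power j)
  have h2 : L.power j * S = (L.power j).pos * S + (L.power j).neg * S := by
    rw [← add_mul, h1]
  rw [h.sato, ← h.pow_mul, ← power_eq_pow, h2]
  abel

theorem IsSolution.exists_dtMulti [hq : Fact (Generic q)] {L S : PDO q} (h : IsSolution L S)
    (s : Multiset ℕ+) :
    ∃ B : PDO q, B.IsDifferential ∧ s.foldr dt (wave S) = wave (B * S) := by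
  induction s using Multiset.induction with
  | empty => exact ⟨1, isDifferential_one, by rw [Multiset.foldr_zero, one_mul]⟩
  | cons j s ih =>
    obtain ⟨B, hB, e⟩ := ih
    -- From `∂_j(B S) + B S D_q^j = (∂_j B) S + B (∂_j S + S D_q^j)` and the evolution equation of
    -- `S`.
    refine ⟨B.tderiv j + B * (L.power j).pos,
      (hB.tderiv j).add (hB.mul hq.out (isDifferential_pos _)), ?_⟩
    rw [Multiset.foldr_cons, e, dt_wave, tderiv_mul, add_mul, mul_assoc B (L.power j).pos,
      ← h.evolution, mul_add, mul_assoc]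
    congr 1
    abel

/-- Every derivative of the wave function is obtained by a differential operator. -/
theorem IsSolution.exists_derivative [hq : Fact (Generic q)] {L S : PDO q} (h : IsSolution L S)
    (n : ℕ) (s : Multiset ℕ+) :
    ∃ B : PDO q, B.IsDifferential ∧ (qD q)^[n] (s.foldr dt (wave S)) = wave (B * S) := by
  induction n with
  | zero => exact h.exists_dtMulti s
  | succ n ih =>
    obtain ⟨B, hB, e⟩ := ih
    refine ⟨dpow 1 B, hB.dpow_one hq.out, ?_⟩
    rw [Function.iterate_succ_apply', e, qD_wave hq.out, dpow_one_mul hq.out]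

theorem coeff_mul_eq_sum_Icc {u v : ZSer} {a b c : ℤ} (hu : ∀ k, k < a → u.coeff k = 0)
    (hv : ∀ k, b < k → v.coeff (c - k) = 0) :
    (u * v).coeff c = ∑ k ∈ Finset.Icc a b, u.coeff k * v.coeff (c - k) := by
  rw [HahnSeries.coeff_mul]
  refine Finset.sum_of_injOn Prod.fst ?_ ?_ ?_ ?_
  · rintro ⟨s, t⟩ hs ⟨s', t'⟩ hs' (h : s = s')
    rw [Finset.mem_coe, Finset.mem_antidiagonal] at hs hs'
    have h1 : s + t = c := hs.2.2
    have h2 : s' + t' = c := hs'.2.2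
    ext <;> simp <;> omega
  · rintro ⟨s, t⟩ hs
    rw [Finset.mem_coe, Finset.mem_antidiagonal] at hs
    have h1 : s + t = c := hs.2.2
    rw [Finset.mem_coe, Finset.mem_Icc]
    constructor
    · by_contra h
      exact hs.1 (hu s (not_le.mp h))
    · by_contra h
      exact hs.2.1 (by
        have := hv s (not_le.mp h)
        rwa [← h1, add_sub_cancel_left] at this)
  · intro k _ hk
    by_contra hne
    refine hk ⟨(k, c - k), ?_, rfl⟩
    rw [Finset.mem_coe, Finset.mem_antidiagonal]
    exact ⟨left_ne_zero_of_mul hne, right_ne_zero_of_mul hne, add_sub_cancel k c⟩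
  · rintro ⟨s, t⟩ hs
    rw [Finset.mem_antidiagonal] at hs
    have h1 : s + t = c := hs.2.2
    rw [← h1, add_sub_cancel_left]

theorem coeff_residue {σ : Type} (F : MvPowerSeries σ ZSer) (m : σ →₀ ℕ) :
    MvPowerSeries.coeff m (residue F) = (MvPowerSeries.coeff m F).coeff 1 := rfl

theorem residue_symbol_mul (P : PDO q) (V : PDO q⁻¹) :
    residue (symbol 1 P * symbol (-1) (V.rescale q)) = pairing P V := by
  classical
  obtain ⟨N, hN⟩ := P.exists_ordLE
  obtain ⟨K, hK⟩ := V.exists_ordLE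
  ext m
  rw [coeff_residue, MvPowerSeries.coeff_mul, HahnSeries.coeff_sum,
    pairing_eq_sum' hN hK (a := -1 - N) (b := K) le_rfl le_rfl, map_sum]
  have h1 : ∀ s ∈ Finset.HasAntidiagonal.antidiagonal m,
      (MvPowerSeries.coeff s.1 (symbol 1 P) *
        MvPowerSeries.coeff s.2 (symbol (-1) (V.rescale q))).coeff 1 =
      ∑ j ∈ Finset.Icc (-1 - N) K, MvPowerSeries.coeff s.1 (P.coeff (-1 - j)) *
        MvPowerSeries.coeff s.2 ((-q) ^ j • shift q (-1) (V.coeff j)) := by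
    intro s _
    rw [coeff_mul_eq_sum_Icc (a := -N) (b := K + 1)]
    -- The Laurent index `k` belongs to `z^(-k)`; to reach `z⁻¹` the other factor must supply
    -- `z^(k-1)`, hence `j = k - 1`.
    · refine Finset.sum_nbij' (fun k => k - 1) (fun j => j + 1) ?_ ?_ ?_ ?_ ?_
      · intro k hk
        rw [Finset.mem_Icc] at *
        omega
      · intro k hk
        rw [Finset.mem_Icc] at *
        omega
      · intro k _
        ring
      · intro k _
        ring
      · intro k _
        have e1 : -1 - (k - 1) = -k := by ring
        have e2 : -(1 - k) = k - 1 := by ring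
        rw [coeff_symbol_one, coeff_symbol, e1, e2, coeff_complex_smul, neg_eq_neg_one_mul q,
          mul_zpow, smul_eq_mul, mul_assoc]
        rfl
    · intro k hk
      rw [coeff_symbol_one, hN _ (by omega), map_zero]
    · intro k hk
      have : (V.rescale q).coeff (-(1 - k)) = 0 := by
        change _ • shift q (-1) _ = _
        rw [hK _ (by omega), shift_zero, smul_zero]
      rw [coeff_symbol, this, map_zero, mul_zero]
  rw [Finset.sum_congr rfl h1, Finset.sum_comm]
  refine Finset.sum_congr rfl fun j _ => ?_
  rw [MvPowerSeries.coeff_mul]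

/-- The bilinear residue on the diagonal is the pairing of operators. -/
theorem residue_wave_mul_adjointWave (hq : Generic q) (P S : PDO q) :
    residue (wave P * adjointWave S) = pairing P S.adjoint.inv := by
  have h : wave P * adjointWave S =
      symbol 1 P * symbol (-1) (S.adjoint.inv.rescale q) * (qExp q z * qExp q⁻¹ (-z)) *
        ((expT fun i => z ^ (i : ℕ)) * expT fun i => -z ^ (i : ℕ)) := by
    have hz : (-1 : ℂ) • z = -z := by
      ext k
      rw [HahnSeries.coeff_smul, HahnSeries.coeff_neg, neg_smul, one_smul]
    rw [wave_eq, adjointWave, actExp, hz]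
    ring
  rw [h, expT_mul_expT_neg hq, qExp_mul_qExp_inv hq, mul_one, mul_one, residue_symbol_mul]

/-- The bilinear identity on the diagonal `(x', t') = (x, t)`. -/
theorem IsSolution.residue_diagonal [hq : Fact (Generic q)] {L S : PDO q} (h : IsSolution L S)
    (n : ℕ) (s : Multiset ℕ+) :
    residue ((qD q)^[n] (s.foldr dt (wave S)) * adjointWave S) = 0 := by
  obtain ⟨B, hB, e⟩ := h.exists_derivative n s
  rw [e, residue_wave_mul_adjointWave hq.out, pairing_mul_adjoint_inv h.monic (hB _ (by omega))]

end Symbols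

/-! ### From the diagonal to independent variables -/

variable {R : Type} [CommRing R] [Algebra ℂ R] {q : ℂ}

/-- A derivative in the times acts on coefficients by a translation and nonzero factors. -/
theorem exists_coeff_foldr_dt (s : Multiset ℕ+) (m : Var →₀ ℕ) :
    ∃ c : ℂ, c ≠ 0 ∧ ∀ f : Ser R, MvPowerSeries.coeff m (s.foldr dt f) =
      c • MvPowerSeries.coeff (m + (s.map fun j => Finsupp.single (some j) 1).sum) f := by
  induction s using Multiset.induction generalizing m with
  | empty => exact ⟨1, one_ne_zero, fun f => by simp⟩
  | cons j s ih =>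
    obtain ⟨c, hc, h⟩ := ih (m + Finsupp.single (some j) 1)
    refine ⟨((m (some j) : ℂ) + 1) * c, mul_ne_zero (Nat.cast_add_one_ne_zero _) hc, fun f => ?_⟩
    have hcast : ((m (some j) : R) + 1) = algebraMap ℂ R ((m (some j) : ℂ) + 1) := by simp
    rw [Multiset.foldr_cons, coeff_dt, h, Multiset.map_cons, Multiset.sum_cons, add_assoc, hcast,
      mul_comm, ← Algebra.smul_def, smul_smul]

/-- A `q`-derivative acts on coefficients by a translation and nonzero factors. -/
theorem exists_coeff_iterate_qD (hq : Generic q) (n : ℕ) (m : Var →₀ ℕ) :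
    ∃ c : ℂ, c ≠ 0 ∧ ∀ f : Ser R, MvPowerSeries.coeff m ((qD q)^[n] f) =
      c • MvPowerSeries.coeff (m + Finsupp.single none n) f := by
  induction n generalizing m with
  | zero => exact ⟨1, one_ne_zero, fun f => by simp⟩
  | succ n ih =>
    obtain ⟨c, hc, h⟩ := ih (m + Finsupp.single none 1)
    refine ⟨(q ^ (m none + 1) - 1) / (q - 1) * c, mul_ne_zero (div_ne_zero
      (sub_ne_zero.mpr (hq.pow_ne_one _ (Nat.succ_pos _))) (sub_ne_zero.mpr hq.ne_one)) hc,
      fun f => ?_⟩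
    rw [Function.iterate_succ_apply', coeff_qD, h, smul_smul, add_assoc, ← Finsupp.single_add,
      add_comm 1 n]

theorem exists_coeff_derivative (hq : Generic q) (n : ℕ) (s : Multiset ℕ+) (m : Var →₀ ℕ) :
    ∃ c : ℂ, c ≠ 0 ∧ ∀ f : Ser R, MvPowerSeries.coeff m ((qD q)^[n] (s.foldr dt f)) =
      c • MvPowerSeries.coeff (m + (Finsupp.single none n +
        (s.map fun j => Finsupp.single (some j) 1).sum)) f := by
  obtain ⟨c, hc, h⟩ := exists_coeff_iterate_qD (R := R) hq n m
  obtain ⟨d, hd, h'⟩ := exists_coeff_foldr_dt (R := R) s (m + Finsupp.single none n)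
  exact ⟨c * d, mul_ne_zero hc hd, fun f => by rw [h, h', smul_smul, add_assoc]⟩

/-- Every exponent is thus the translation effected by some derivative in `exists_coeff_derivative`.
-/
theorem exists_eq_single_add_sum (m : Var →₀ ℕ) : ∃ (n : ℕ) (s : Multiset ℕ+),
    m = Finsupp.single none n + (s.map fun j => Finsupp.single (some j) 1).sum := by
  induction m using Finsupp.induction_linear with
  | zero => exact ⟨0, 0, by simp⟩
  | add f g hf hg =>
    obtain ⟨n, s, rfl⟩ := hf
    obtain ⟨n', s', rfl⟩ := hg
    refine ⟨n + n', s + s', ?_⟩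
    rw [Multiset.map_add, Multiset.sum_add, Finsupp.single_add, add_add_add_comm]
  | single i k =>
    cases i with
    | none => exact ⟨k, 0, by simp⟩
    | some j =>
      refine ⟨0, Multiset.replicate k j, ?_⟩
      rw [Multiset.map_replicate, Multiset.sum_replicate]
      simp

theorem coeff_smul_mul (c : ℂ) (a b : ZSer) (k : ℤ) :
    ((algebraMap ℂ ZSer c * a) * b).coeff k = c * (a * b).coeff k := by
  rw [mul_assoc, coeff_algebraMap_mul]

/-- If all bilinear residues of derivatives of `F` with `G` vanish on the diagonal, then the
residues of the products of all coefficients vanish. -/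
theorem coeff_mul_coeff_eq_zero (hq : Generic q) {F G : Ser ZSer}
    (h : ∀ (n : ℕ) (s : Multiset ℕ+), residue ((qD q)^[n] (s.foldr dt F) * G) = 0)
    (m m' : Var →₀ ℕ) : (MvPowerSeries.coeff m F * MvPowerSeries.coeff m' G).coeff 1 = 0 := by
  classical
  induction m' using WellFoundedLT.induction generalizing m with
  | ind m' ih =>
    -- With the derivative that translates exponent `0` to `m`, the term `(0, m')` of the Cauchy
    -- product is a nonzero multiple of the wanted residue. Every other term pairs some coefficient
    -- of `F` with one of `G` at `b < m'` and vanishes by induction, which is why `m` is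
    -- generalized.
    obtain ⟨n, s, hm⟩ := exists_eq_single_add_sum m
    have h1 := congrArg (MvPowerSeries.coeff m') (h n s)
    rw [coeff_residue, MvPowerSeries.coeff_mul, HahnSeries.coeff_sum, map_zero,
      Finset.sum_eq_single (0, m')] at h1
    · obtain ⟨c, hc, e⟩ := exists_coeff_derivative (R := ZSer) hq n s 0
      rw [e, zero_add, ← hm, Algebra.smul_def, coeff_smul_mul] at h1
      exact (mul_eq_zero.mp h1).resolve_left hc
    · rintro ⟨a, b⟩ hab hne
      have hab : a + b = m' := Finset.HasAntidiagonal.mem_antidiagonal.mp hab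
      obtain ⟨c, -, e⟩ := exists_coeff_derivative (R := ZSer) hq n s a
      simp only
      rw [e, Algebra.smul_def, coeff_smul_mul, ih b, mul_zero]
      refine lt_of_le_of_ne (hab ▸ le_add_self) fun hb => hne ?_
      rw [hb] at hab ⊢
      rw [add_eq_right.mp hab]
    · intro hn
      exact absurd (Finset.HasAntidiagonal.mem_antidiagonal.mpr (zero_add m')) hn

theorem residue_tensor_eq_zero {F G : Ser ZSer}
    (h : ∀ m m' : Var →₀ ℕ,
      (MvPowerSeries.coeff m F * MvPowerSeries.coeff m' G).coeff 1 = 0) :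
    residue (tensor F G) = 0 := by
  classical
  ext M
  rw [coeff_residue, tensor, MvPowerSeries.coeff_mul, HahnSeries.coeff_sum, map_zero]
  refine Finset.sum_eq_zero fun s _ => ?_
  rw [MvPowerSeries.coeff_rename, MvPowerSeries.coeff_rename, Finset.sum_mul_sum,
    HahnSeries.coeff_sum]
  refine Finset.sum_eq_zero fun a _ => ?_
  rw [HahnSeries.coeff_sum]
  exact Finset.sum_eq_zero fun b _ => h a b

end QKP

end

theorem theorem4p3 (q : ℂ) (hq0 : q ≠ 0) (hq : ∀ k : ℕ, 0 < k → q ^ k ≠ 1)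
    (L S : QKP.PDO q) (hLS : QKP.IsSolution L S) (n : ℕ) (α : ℕ+ →₀ ℕ) :
    QKP.residue
      (QKP.tensor ((QKP.qD q)^[n] (QKP.dtMulti α (QKP.wave S))) (QKP.adjointWave S)) = 0 := by
  have hg : QKP.Generic q := ⟨hq0, hq⟩
  have : Fact (QKP.Generic q) := ⟨hg⟩
  refine QKP.residue_tensor_eq_zero fun m m' => ?_
  -- A coefficient of the derivative is a multiple of a single coefficient of the wave function, so
  -- only products of undifferentiated coefficients remain.
  obtain ⟨c, -, e⟩ := QKP.exists_coeff_derivative (R := QKP.ZSer) hg n (Finsupp.toMultiset α) m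
  rw [QKP.dtMulti, e, Algebra.smul_def, QKP.coeff_smul_mul,
    QKP.coeff_mul_coeff_eq_zero hg hLS.residue_diagonal, mul_zero]
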